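/- Let $X$ be a compact smooth $n$-dimensional manifold without boundary. An Einstein flow on $X$ over an interval $I\subset\mathbb R$ is a smooth family $(L(t),h(t),K(t))_{t\in I}$ of nonnegative functions $L$, Riemannian metrics $h$ and symmetric covariant $2$-tensor fields $K$ on $X$ such that, with $H=h^{ij}K_{ij}$, $K^0=K-\frac Hn h$ and with $R_{ij}$, $R$ the Ricci and scalar curvature of $h$, $$R-|K^0|^2+\Bigl(1-\frac1n\Bigr)H^2=0,\qquad \nabla_iK^i{}_j-\nabla_jH=0,$$ $$\frac{\partial h_{ij}}{\partial t}=-2LK_{ij},\qquad \frac{\partial K_{ij}}{\partial t}=LHK_{ij}-2Lh^{kl}K_{ik}K_{lj}-L_{;ij}+LR_{ij}.$$ It is an expanding CMC Einstein flow if $I=[t_0,\infty)$ or $I=(t_0,\infty)$ and $H$ is a negative, monotonically increasing function of $t$ alone that takes all values in $[H_0,0)$ for some $H_0<0$. Let $(L,h,K)$ be an expanding CMC Einstein flow on $X$ whose time parameter is the Hubble time $t=-n/H$. Then: (a) The measures $t^{-n}\,\mathrm{dvol}(X,h(t))$ are nonincreasing in $t\in I$, and there is a finite measure $\mathrm{dvol}_\infty$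 on $X$, absolutely continuous with respect to $\mathrm{dvol}(X,h(t))$ for each $t\in I$, such that $t^{-n}\,\mathrm{vol}(A,h(t))\to\mathrm{dvol}_\infty(A)$ as $t\to\infty$ for every Borel set $A\subset X$. (b) As $t\to\infty$, the density $\dfrac{t^{-n}\,\mathrm{dvol}(X,h(t))}{\mathrm{dvol}_\infty}$ (the Radon–Nikodym derivative of the $\mathrm{dvol}_\infty$-absolutely continuous part) tends to $1$ in $L^1(X,\mathrm{dvol}_\infty)$. (c) For $s>0$ put $L_s(u)=L(su)$, $h_s(u)=s^{-2}h(su)$, $K_s(u)=s^{-1}K(su)$, and let $|K^0|^2_s$ and $R_s$ be the squared norm of the trace-free part of $K_s$ with respect to $h_s$ and the scalar curvature of $h_s$. Then for every $\Lambda>1$, as $s\to\infty$, $$L_s-1\to0,\qquad |K^0|_s^2\,L_s\to0,\qquad \Bigl|R_s+\frac{n(n-1)}{u^2}\Bigr|L_s\to0$$ in $L^1\bigl([\Lambda^{-1},\Lambda]\times X,\ du\,\mathrm{dvol}_\infty\bigr)$. -/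

import Mathlib

open MeasureTheory Filter Topology Set
open scoped Manifold ContDiff ENNReal

noncomputable section

/-- The model space of `n`-dimensional manifolds. -/
abbrev Coord (n : ℕ) : Type := EuclideanSpace ℝ (Fin n)

/-- The components of a covariant 2-tensor field in a coordinate domain. -/
abbrev CoordTensor (n : ℕ) : Type := Coord n → Matrix (Fin n) (Fin n) ℝ

/-! ### Tensor calculus in local coordinates

`G` is the matrix `(h_ij)` of a Riemannian metric in a chart, so `(G y)⁻¹` is `(h^ij)`. -/

namespace CoordTensor

variable {n : ℕ}

/-- The coordinate partial derivative `∂_k f`. -/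
def pderiv (k : Fin n) (f : Coord n → ℝ) (y : Coord n) : ℝ :=
  fderiv ℝ f y (EuclideanSpace.single k 1)

/-- The trace `h^ij K_ij`. -/
def trace (G K : CoordTensor n) (y : Coord n) : ℝ :=
  ∑ i, ∑ j, (G y)⁻¹ i j * K y i j

/-- The trace-free part `K_ij - (h^kl K_kl / n) h_ij`. -/
def traceFree (G K : CoordTensor n) : CoordTensor n :=
  fun y => K y - (trace G K y / n) • G y

/-- The squared norm `h^ik h^jl T_ij T_kl`. -/
def normSq (G T : CoordTensor n) (y : Coord n) : ℝ :=
  ∑ i, ∑ j, ∑ k, ∑ l, (G y)⁻¹ i k * (G y)⁻¹ j l * T y i j * T y k l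

/-- The Christoffel symbol `Γ^k_ij = (1/2) h^kl (∂_i h_jl + ∂_j h_il - ∂_l h_ij)`. -/
def christoffel (G : CoordTensor n) (k i j : Fin n) (y : Coord n) : ℝ :=
  (1 / 2) * ∑ l, (G y)⁻¹ k l *
    (pderiv i (fun z => G z j l) y + pderiv j (fun z => G z i l) y
      - pderiv l (fun z => G z i j) y)

/-- The Ricci curvature
`R_ij = ∂_k Γ^k_ij - ∂_j Γ^k_ik + Γ^k_kl Γ^l_ij - Γ^k_jl Γ^l_ik`. -/
def ricci (G : CoordTensor n) (i j : Fin n) (y : Coord n) : ℝ :=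
  ∑ k, (pderiv k (christoffel G k i j) y - pderiv j (christoffel G k i k) y
    + ∑ l, (christoffel G k k l y * christoffel G l i j y
      - christoffel G k j l y * christoffel G l i k y))

/-- The scalar curvature `h^ij R_ij`. -/
def scalar (G : CoordTensor n) (y : Coord n) : ℝ :=
  ∑ i, ∑ j, (G y)⁻¹ i j * ricci G i j y

/-- The Hessian `f_{;ij} = ∂_i ∂_j f - Γ^k_ij ∂_k f`. -/
def hessian (G : CoordTensor n) (f : Coord n → ℝ) (i j : Fin n) (y : Coord n) : ℝ :=
  pderiv i (pderiv j f) y - ∑ k, christoffel G k i j y * pderiv k f y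

/-- The covariant derivative `∇_k T_ij = ∂_k T_ij - Γ^l_ki T_lj - Γ^l_kj T_il`. -/
def covDeriv (G T : CoordTensor n) (k i j : Fin n) (y : Coord n) : ℝ :=
  pderiv k (fun z => T z i j) y
    - ∑ l, (christoffel G l k i y * T y l j + christoffel G l k j y * T y i l)

/-- The divergence `∇_i T^i_j = h^ik ∇_k T_ij`. -/
def divergence (G T : CoordTensor n) (j : Fin n) (y : Coord n) : ℝ :=
  ∑ i, ∑ k, (G y)⁻¹ i k * covDeriv G T k i j y

end CoordTensor

/-! ### Tensor fields on a manifold -/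

section Manifold

variable (n : ℕ) (X : Type*) [TopologicalSpace X] [ChartedSpace (Coord n) X]

/-- A (not necessarily smooth) covariant 2-tensor field on `X`. -/
abbrev TwoTensor : Type _ :=
  (x : X) → TangentSpace (𝓡 n) x →L[ℝ] TangentSpace (𝓡 n) x →L[ℝ] ℝ

variable {n X}

/-- The `i`-th coordinate vector field of the chart `c`, at the point with coordinates `y`. -/
def coordVector (c : OpenPartialHomeomorph X (Coord n)) (y : Coord n) (i : Fin n) :
    TangentSpace (𝓡 n) (c.symm y) :=
  mfderiv (𝓡 n) (𝓡 n) c.symm y (EuclideanSpace.single i 1 : Coord n)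

namespace TwoTensor

/-- The components of a 2-tensor field in the chart `c`; meaningful on `c.target`. -/
def comp (T : TwoTensor n X) (c : OpenPartialHomeomorph X (Coord n)) : CoordTensor n :=
  fun y => Matrix.of fun i j => T (c.symm y) (coordVector c y i) (coordVector c y j)

/-- The trace `h^ij K_ij` as a function on `X`, computed in a chart around the point. -/
def trace (h K : TwoTensor n X) (x : X) : ℝ :=
  CoordTensor.trace (h.comp (chartAt (Coord n) x)) (K.comp (chartAt (Coord n) x))
    (chartAt (Coord n) x x)

/-- `|K^0|^2` as a function on `X`, where `K^0` is the trace-free part of `K` and the norm and the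
trace are those of the metric `h`. -/
def traceFreeNormSq (h K : TwoTensor n X) (x : X) : ℝ :=
  CoordTensor.normSq (h.comp (chartAt (Coord n) x))
    (CoordTensor.traceFree (h.comp (chartAt (Coord n) x)) (K.comp (chartAt (Coord n) x)))
    (chartAt (Coord n) x x)

/-- The scalar curvature of the metric `h` as a function on `X`. -/
def scalarCurvature (h : TwoTensor n X) (x : X) : ℝ :=
  CoordTensor.scalar (h.comp (chartAt (Coord n) x)) (chartAt (Coord n) x x)

variable [MeasurableSpace X]

/-- The Riemannian measure of `h` on the domain of the chart `c`, as a measure on `X` that vanishes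
outside that domain: the image of `√(det h_ij) dy` under the inverse of the chart. -/
def chartVolume (h : TwoTensor n X) (c : OpenPartialHomeomorph X (Coord n)) : Measure X :=
  Measure.map c.symm ((volume.restrict c.target).withDensity
    fun y => ENNReal.ofReal (Real.sqrt (h.comp c y).det))

/-- The Riemannian measure `dvol(X, h)`: the least measure on `X` that dominates
`√(det h_ij) dy` on the domain of every chart. By the change of variables formula the measures of
two charts agree on the intersection of their domains, so this is the measure that is given by
`√(det h_ij) dy` on the domain of each chart. -/
def volumeMeasure (h : TwoTensor n X) : Measure X :=
  ⨆ c ∈ atlas (Coord n) X, h.chartVolume c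

end TwoTensor

/-! ### Einstein flows -/

variable (n X)

/-- The data of a flow: the lapse functions `L(t)`, metrics `h(t)` and 2-tensor fields `K(t)`.
Only the values at times in the time interval under consideration matter. -/
structure FlowData where
  L : ℝ → X → ℝ
  h : ℝ → TwoTensor n X
  K : ℝ → TwoTensor n X

variable {n X}

namespace FlowData

/-- The mean curvature `H = h^ij K_ij`. -/
def H (F : FlowData n X) (t : ℝ) (x : X) : ℝ := (F.h t).trace (F.K t) x

/-- `|K^0|^2`, where `K^0 = K - (H/n) h`. -/
def K0sq (F : FlowData n X) (t : ℝ) (x : X) : ℝ := (F.h t).traceFreeNormSq (F.K t) x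

/-- The scalar curvature of `h(t)`. -/
def R (F : FlowData n X) (t : ℝ) (x : X) : ℝ := (F.h t).scalarCurvature x

/-- The rescaled flow `L_s(u) = L(su)`, `h_s(u) = s⁻² h(su)`, `K_s(u) = s⁻¹ K(su)`. -/
def rescale (F : FlowData n X) (s : ℝ) : FlowData n X where
  L u := F.L (s * u)
  h u := fun x => (s ^ 2)⁻¹ • F.h (s * u) x
  K u := fun x => s⁻¹ • F.K (s * u) x

/-- The normalized volume measure `t⁻ⁿ dvol(X, h(t))`. -/
def normalizedVolume [MeasurableSpace X] (F : FlowData n X) (t : ℝ) : Measure X :=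
  ENNReal.ofReal (t ^ n)⁻¹ • (F.h t).volumeMeasure

/-- A smooth Einstein flow with time interval `I`. Smoothness is joint smoothness in time and
space of the components in local coordinates, and the tensor equations are required in every chart
of the atlas. At an endpoint of `I` time derivatives are one-sided. -/
structure IsEinsteinFlow (I : Set ℝ) (F : FlowData n X) : Prop where
  interval : I.OrdConnected
  lapse_nonneg : ∀ t ∈ I, ∀ x, 0 ≤ F.L t x
  metric_symm : ∀ t ∈ I, ∀ x v w, F.h t x v w = F.h t x w v
  metric_pos : ∀ t ∈ I, ∀ x v, v ≠ 0 → 0 < F.h t x v v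
  K_symm : ∀ t ∈ I, ∀ x v w, F.K t x v w = F.K t x w v
  smooth_L : ∀ c ∈ atlas (Coord n) X,
    ContDiffOn ℝ ∞ (fun p : ℝ × Coord n => F.L p.1 (c.symm p.2)) (I ×ˢ c.target)
  smooth_h : ∀ c ∈ atlas (Coord n) X, ∀ i j,
    ContDiffOn ℝ ∞ (fun p : ℝ × Coord n => (F.h p.1).comp c p.2 i j) (I ×ˢ c.target)
  smooth_K : ∀ c ∈ atlas (Coord n) X, ∀ i j,
    ContDiffOn ℝ ∞ (fun p : ℝ × Coord n => (F.K p.1).comp c p.2 i j) (I ×ˢ c.target)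
  /-- `R - |K^0|^2 + (1 - 1/n) H^2 = 0` -/
  hamiltonian : ∀ t ∈ I, ∀ c ∈ atlas (Coord n) X, ∀ y ∈ c.target,
    CoordTensor.scalar ((F.h t).comp c) y
      - CoordTensor.normSq ((F.h t).comp c)
          (CoordTensor.traceFree ((F.h t).comp c) ((F.K t).comp c)) y
      + (1 - 1 / (n : ℝ)) * CoordTensor.trace ((F.h t).comp c) ((F.K t).comp c) y ^ 2 = 0
  /-- `∇_i K^i_j - ∇_j H = 0` -/
  momentum : ∀ t ∈ I, ∀ c ∈ atlas (Coord n) X, ∀ y ∈ c.target, ∀ j,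
    CoordTensor.divergence ((F.h t).comp c) ((F.K t).comp c) j y
      - CoordTensor.pderiv j
          (CoordTensor.trace ((F.h t).comp c) ((F.K t).comp c)) y = 0
  /-- `∂h_ij/∂t = -2 L K_ij` -/
  evolution_h : ∀ t ∈ I, ∀ c ∈ atlas (Coord n) X, ∀ y ∈ c.target, ∀ i j,
    HasDerivWithinAt (fun τ => (F.h τ).comp c y i j)
      (-2 * F.L t (c.symm y) * (F.K t).comp c y i j) I t
  /-- `∂K_ij/∂t = L H K_ij - 2 L h^kl K_ik K_lj - L_{;ij} + L R_ij` -/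
  evolution_K : ∀ t ∈ I, ∀ c ∈ atlas (Coord n) X, ∀ y ∈ c.target, ∀ i j,
    HasDerivWithinAt (fun τ => (F.K τ).comp c y i j)
      (F.L t (c.symm y) * CoordTensor.trace ((F.h t).comp c) ((F.K t).comp c) y
            * (F.K t).comp c y i j
        - 2 * F.L t (c.symm y) * ∑ k, ∑ l, ((F.h t).comp c y)⁻¹ k l
            * (F.K t).comp c y i k * (F.K t).comp c y l j
        - CoordTensor.hessian ((F.h t).comp c) (fun z => F.L t (c.symm z)) i j y
        + F.L t (c.symm y) * CoordTensor.ricci ((F.h t).comp c) i j y) I t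

/-- An expanding CMC Einstein flow: the time interval is `[t₀, ∞)` or `(t₀, ∞)`, and `H` is a
negative nondecreasing function of `t` alone that takes all values in `[H₀, 0)` for some
`H₀ < 0`. -/
structure IsExpandingCMC (I : Set ℝ) (F : FlowData n X) : Prop extends
    IsEinsteinFlow I F where
  future : ∃ t₀ : ℝ, I = Ici t₀ ∨ I = Ioi t₀
  cmc : ∃ η : ℝ → ℝ, (∀ t ∈ I, ∀ x, F.H t x = η t) ∧ MonotoneOn η I ∧ (∀ t ∈ I, η t < 0) ∧
    ∃ H₀ < 0, Ico H₀ 0 ⊆ η '' I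

/-- The time parameter of the flow is the Hubble time `t = -n/H`. -/
def IsHubbleTime (I : Set ℝ) (F : FlowData n X) : Prop :=
  ∀ t ∈ I, ∀ x, t = -(n : ℝ) / F.H t x

end FlowData

end Manifold

/-- `F s → 0` in `L¹(μ)` as `s → ∞`. -/
def TendstoZeroL1 {α : Type*} [MeasurableSpace α] (μ : Measure α) (F : ℝ → α → ℝ) : Prop :=
  (∀ᶠ s in atTop, MemLp (F s) 1 μ) ∧ Tendsto (fun s => eLpNorm (F s) 1 μ) atTop (𝓝 0)

end

/-! Write `k` for `|K^0|^2`. In Hubble time the trace of `K` is the known function `-n/t`.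
Differentiating it with the evolution equations and eliminating the scalar curvature by the
Hamiltonian constraint gives the elliptic equation `ΔL = k L - (n/t²)(1 - L)` (`lapse_equation`). On
a closed manifold it is used twice: at a maximum of `L` it forces `L ≤ 1` (`lapse_le_one`), and its
integral says that `k L` and `(n/t²)(1 - L)` have the same total (`integral_K0sq_mul_L`).

The Riemannian density has logarithmic derivative `-LH = nL/t`, so the normalized density has
logarithmic derivative `(n/t)(L - 1) ≤ 0` (`hasDerivWithinAt_density`). It therefore decreases
pointwise to a limit, and dominated convergence yields the limit measure (`exists_limit`). This
measure lies below every normalized volume, so the L¹ distance in (b) is bounded by the difference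
of total masses (`eLpNorm_rnDeriv_sub_one_le`).

For (c), integrating the derivative of the density over times from `s/Λ` to `sΛ` bounds the integral
of `1 - L` by a multiple of the mass lost between these times, which tends to zero because the mass
converges (`lintegral_one_sub_L_le`). The integrated lapse equation transfers the bound to `s² k L`.
The Hamiltonian constraint reads `R + n(n-1)/t² = k` (`R_eq`), so the third convergence is the
second one again.

The geometric input is that trace, norm and volume are independent of the chart, and that a
Laplacian integrates to zero. `IsDensityFlow` collects what the measure-theoretic half needs. -/

noncomputable section

/-! ### Matrix calculus -/

namespace Matrix

variable {m : Type*} [Fintype m] [DecidableEq m]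

/-- Jacobi's formula for the derivative of a determinant. -/
theorem hasDerivWithinAt_det {A : ℝ → Matrix m m ℝ} {A' : Matrix m m ℝ} {s : Set ℝ} {t : ℝ}
    (hA : ∀ i j, HasDerivWithinAt (fun τ => A τ i j) (A' i j) s t) :
    HasDerivWithinAt (fun τ => (A τ).det) (trace ((A t).adjugate * A')) s t := by
  -- By Cramer's rule the trace is the sum of the determinants in which one column of `A` is
  -- replaced by that of `A'`. Their Leibniz expansions are the terms of the product rule.
  have key : trace ((A t).adjugate * A') = ∑ σ : Equiv.Perm m, ((Equiv.Perm.sign σ : ℤ) : ℝ) *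
      ∑ i, (∏ j ∈ Finset.univ.erase i, A t (σ j) j) • A' (σ i) i := by
    have h1 : trace ((A t).adjugate * A') =
        ∑ i, ((A t).updateCol i (fun k => A' k i)).det := by
      simp only [trace, diag_apply]
      refine Finset.sum_congr rfl fun i _ => ?_
      rw [← cramer_apply, cramer_eq_adjugate_mulVec]
      rfl
    rw [h1]
    simp only [det_apply', Finset.mul_sum]
    rw [Finset.sum_comm]
    refine Finset.sum_congr rfl fun σ _ => Finset.sum_congr rfl fun i _ => ?_
    rw [← Finset.mul_prod_erase _ _ (Finset.mem_univ i), updateCol_self, smul_eq_mul,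
      mul_comm (A' (σ i) i)]
    congr 2
    refine Finset.prod_congr rfl fun j hj => ?_
    rw [updateCol_ne (Finset.ne_of_mem_erase hj)]
  rw [key]
  simp only [det_apply']
  refine HasDerivWithinAt.fun_sum fun σ _ => ?_
  exact (HasDerivWithinAt.fun_finsetProd fun i _ => hA (σ i) i).const_mul _

theorem adjugate_eq_det_smul_inv {A : Matrix m m ℝ} (hA : A.det ≠ 0) :
    A.adjugate = A.det • A⁻¹ := by
  rw [inv_def, smul_smul, Ring.inverse_eq_inv', mul_inv_cancel₀ hA, one_smul]

theorem tendsto_inv_apply {α : Type*} {l : Filter α} {A : α → Matrix m m ℝ} {B : Matrix m m ℝ}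
    (hA : ∀ i j, Tendsto (fun a => A a i j) l (𝓝 (B i j))) (hB : B.det ≠ 0) (i j : m) :
    Tendsto (fun a => (A a)⁻¹ i j) l (𝓝 (B⁻¹ i j)) := by
  have hA' : Tendsto A l (𝓝 B) := by
    refine tendsto_pi_nhds.2 fun i => tendsto_pi_nhds.2 fun j => hA i j
  have h1 : Tendsto (fun a => (A a).det) l (𝓝 B.det) :=
    (continuous_id.matrix_det.tendsto B).comp hA'
  have h2 : Tendsto (fun a => (A a).adjugate i j) l (𝓝 (B.adjugate i j)) :=
    ((continuous_id.matrix_adjugate.matrix_elem i j).tendsto B).comp hA'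
  simp only [inv_def, Ring.inverse_eq_inv', smul_apply, smul_eq_mul]
  exact (h1.inv₀ hB).mul h2

/-- The derivative of the inverse matrix is `-A⁻¹ A' A⁻¹`. -/
theorem hasDerivWithinAt_inv {A : ℝ → Matrix m m ℝ} {A' : Matrix m m ℝ} {s : Set ℝ} {t : ℝ}
    (hA : ∀ i j, HasDerivWithinAt (fun τ => A τ i j) (A' i j) s t) (h0 : (A t).det ≠ 0) (i j : m) :
    HasDerivWithinAt (fun τ => (A τ)⁻¹ i j) ((-((A t)⁻¹ * A' * (A t)⁻¹)) i j) s t := by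
  have hcont : ∀ i j, Tendsto (fun τ => A τ i j) (𝓝[s] t) (𝓝 (A t i j)) := fun i j =>
    (hA i j).continuousWithinAt
  have hinv := tendsto_inv_apply hcont h0
  have hdet : ∀ᶠ τ in 𝓝[s] t, (A τ).det ≠ 0 :=
    (hasDerivWithinAt_det hA).continuousWithinAt.eventually_ne h0
  rw [hasDerivWithinAt_iff_tendsto_slope]
  have hs := fun i j => (hasDerivWithinAt_iff_tendsto_slope.1 (hA i j))
  have hle : 𝓝[s \ {t}] t ≤ 𝓝[s] t := nhdsWithin_mono _ sdiff_subset
  have hlim : Tendsto (fun τ => -∑ a, (∑ b, (A τ)⁻¹ i b * slope (fun τ => A τ b a) t τ) *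
      (A t)⁻¹ a j) (𝓝[s \ {t}] t) (𝓝 ((-((A t)⁻¹ * A' * (A t)⁻¹)) i j)) := by
    simp only [neg_apply, mul_apply]
    refine (tendsto_finsetSum _ fun a _ => ?_).neg
    refine Tendsto.mul_const _ (tendsto_finsetSum _ fun b _ => ?_)
    exact ((hinv i b).mono_left hle).mul (hs b a)
  refine hlim.congr' ?_
  filter_upwards [hle hdet] with τ hτ
  -- The resolvent identity turns the slope of the inverse into the slope of `A` between two
  -- inverses, and only the continuity of the inverse remains to be used.
  have e : (A τ)⁻¹ - (A t)⁻¹ = -((A τ)⁻¹ * (A τ - A t) * (A t)⁻¹) := by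
    rw [mul_sub, sub_mul, nonsing_inv_mul _ (isUnit_iff_ne_zero.2 hτ), one_mul, mul_assoc,
      mul_nonsing_inv _ (isUnit_iff_ne_zero.2 h0), mul_one, neg_sub]
  have e' := congrFun (congrFun e i) j
  simp only [sub_apply, neg_apply, mul_apply] at e'
  simp only [slope_def_field]
  rw [e']
  rw [neg_div, Finset.sum_div]
  congr 1
  refine Finset.sum_congr rfl fun a _ => ?_
  rw [mul_div_right_comm, Finset.sum_div]
  congr 1
  refine Finset.sum_congr rfl fun b _ => ?_
  rw [mul_div_assoc]

section ContDiffOn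

variable {E : Type*} [NormedAddCommGroup E] [NormedSpace ℝ E] {s : Set E} {A : E → Matrix m m ℝ}
  {N : WithTop ℕ∞}

theorem contDiffOn_det (hA : ∀ i j, ContDiffOn ℝ N (fun y => A y i j) s) :
    ContDiffOn ℝ N (fun y => (A y).det) s := by
  simp only [det_apply']
  refine ContDiffOn.sum fun σ _ => contDiffOn_const.mul ?_
  exact contDiffOn_prod fun i _ => hA (σ i) i

theorem contDiffOn_inv_apply (hA : ∀ i j, ContDiffOn ℝ N (fun y => A y i j) s)
    (h0 : ∀ y ∈ s, (A y).det ≠ 0) (i j : m) : ContDiffOn ℝ N (fun y => (A y)⁻¹ i j) s := by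
  simp only [inv_def, Ring.inverse_eq_inv', smul_apply, smul_eq_mul, adjugate_apply]
  refine ((contDiffOn_det hA).inv h0).mul (contDiffOn_det fun a b => ?_)
  by_cases h : a = j
  · subst h
    simpa only [updateRow_self] using contDiffOn_const
  · simpa only [updateRow_ne h] using hA a b

end ContDiffOn

/-! ### Trace and norm with respect to an inner product matrix -/

/-- The trace `g^ij T_ij` of `T` with respect to the matrix `g`. -/
def metricTrace (g T : Matrix m m ℝ) : ℝ := trace (g⁻¹ * Tᵀ)

/-- The squared norm `g^ik g^jl T_ij T_kl` of `T` with respect to the matrix `g`. -/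
def metricNormSq (g T : Matrix m m ℝ) : ℝ := trace (g⁻¹ᵀ * T * g⁻¹ * Tᵀ)

theorem metricTrace_eq_sum (g T : Matrix m m ℝ) :
    metricTrace g T = ∑ i, ∑ j, g⁻¹ i j * T i j := by
  simp [metricTrace, trace, mul_apply]

theorem metricNormSq_eq_sum (g T : Matrix m m ℝ) :
    metricNormSq g T = ∑ i, ∑ j, ∑ k, ∑ l, g⁻¹ i k * g⁻¹ j l * T i j * T k l := by
  simp only [metricNormSq, trace, diag_apply, mul_apply, transpose_apply, Finset.sum_mul]
  calc _ = ∑ k, ∑ l, ∑ i, ∑ j, g⁻¹ i k * g⁻¹ j l * T i j * T k l := by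
        refine Finset.sum_congr rfl fun k _ => Finset.sum_congr rfl fun l _ => ?_
        rw [Finset.sum_comm]
        refine Finset.sum_congr rfl fun i _ => Finset.sum_congr rfl fun j _ => ?_
        ring
    _ = ∑ k, ∑ i, ∑ l, ∑ j, g⁻¹ i k * g⁻¹ j l * T i j * T k l :=
        Finset.sum_congr rfl fun k _ => Finset.sum_comm
    _ = ∑ i, ∑ k, ∑ l, ∑ j, g⁻¹ i k * g⁻¹ j l * T i j * T k l := Finset.sum_comm
    _ = ∑ i, ∑ k, ∑ j, ∑ l, g⁻¹ i k * g⁻¹ j l * T i j * T k l :=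
        Finset.sum_congr rfl fun i _ => Finset.sum_congr rfl fun k _ => Finset.sum_comm
    _ = _ := Finset.sum_congr rfl fun i _ => Finset.sum_comm

variable {g T J : Matrix m m ℝ}

/-- The factors `J` cancel by cyclicity of the trace. A change of coordinates acts on components by
such a congruence, so this is the chart independence of `h^ij K_ij`; the next lemma does the same
for the norm. -/
theorem metricTrace_congruence (hJ : J.det ≠ 0) :
    metricTrace (Jᵀ * g * J) (Jᵀ * T * J) = metricTrace g T := by
  have h1 : J * J⁻¹ = 1 := mul_nonsing_inv _ (isUnit_iff_ne_zero.2 hJ)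
  have h2 : (Jᵀ)⁻¹ * Jᵀ = 1 := nonsing_inv_mul _ (isUnit_iff_ne_zero.2 (by simpa using hJ))
  simp only [metricTrace, mul_inv_rev, transpose_mul, transpose_transpose]
  calc trace (J⁻¹ * (g⁻¹ * Jᵀ⁻¹) * (Jᵀ * (Tᵀ * J)))
      = trace (J⁻¹ * (g⁻¹ * (Jᵀ⁻¹ * Jᵀ) * Tᵀ * J)) := by simp only [mul_assoc]
    _ = trace (g⁻¹ * Tᵀ) := by
        rw [h2, mul_one, trace_mul_comm, mul_assoc, h1, mul_one]

theorem metricNormSq_congruence (hJ : J.det ≠ 0) :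
    metricNormSq (Jᵀ * g * J) (Jᵀ * T * J) = metricNormSq g T := by
  have h1 : J * J⁻¹ = 1 := mul_nonsing_inv _ (isUnit_iff_ne_zero.2 hJ)
  have h2 : (Jᵀ)⁻¹ * Jᵀ = 1 := nonsing_inv_mul _ (isUnit_iff_ne_zero.2 (by simpa using hJ))
  have h3 : J⁻¹ᵀ = (Jᵀ)⁻¹ := transpose_nonsing_inv J
  simp only [metricNormSq, mul_inv_rev, transpose_mul, transpose_transpose]
  rw [← h3, transpose_transpose]
  have h4 : J⁻¹ᵀ * Jᵀ = 1 := by rw [h3, h2]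
  calc trace (J⁻¹ * g⁻¹ᵀ * J⁻¹ᵀ * (Jᵀ * T * J) * (J⁻¹ * (g⁻¹ * J⁻¹ᵀ)) * (Jᵀ * (Tᵀ * J)))
      = trace (J⁻¹ * (g⁻¹ᵀ * (J⁻¹ᵀ * Jᵀ) * T * (J * J⁻¹) * g⁻¹ * (J⁻¹ᵀ * Jᵀ) * Tᵀ * J)) := by
        simp only [mul_assoc]
    _ = _ := by
        rw [h4, h1, trace_mul_comm, mul_assoc _ J, h1]; simp only [mul_one]

-- A decomposition into rank-one squares. Applied to an inverse metric, it proves both the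
-- positivity of the tensor norm and the sign of the Laplacian at a maximum.
omit [DecidableEq m] in
theorem PosSemidef.exists_eq_transpose_mul_self {P : Matrix m m ℝ} (hP : P.PosSemidef) :
    ∃ (k : ℕ) (v : Fin k → m → ℝ), ∀ i j, P i j = ∑ a, v a i * v a j := by
  obtain ⟨k, v, hv⟩ := posSemidef_iff_eq_sum_vecMulVec.1 hP
  refine ⟨k, v, fun i j => ?_⟩
  rw [hv, sum_apply]
  simp [vecMulVec_apply]

/-- With `g⁻¹` written as a sum of rank-one squares, the norm becomes a sum of squares of
contractions of `T`. No symmetry of `T` is needed. -/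
theorem metricNormSq_nonneg (hg : g.PosDef) : 0 ≤ metricNormSq g T := by
  obtain ⟨k, v, hv⟩ := hg.inv.posSemidef.exists_eq_transpose_mul_self
  rw [metricNormSq_eq_sum]
  have : ∑ i, ∑ j, ∑ k, ∑ l, g⁻¹ i k * g⁻¹ j l * T i j * T k l =
      ∑ a, ∑ b, (∑ i, ∑ j, v a i * v b j * T i j) ^ 2 := by
    have e : ∀ a b, (∑ i, ∑ j, v a i * v b j * T i j) ^ 2 = ∑ i, ∑ j, ∑ k, ∑ l,
        v a i * v a k * (v b j * v b l) * T i j * T k l := by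
      intro a b
      rw [sq, Finset.sum_mul]
      refine Finset.sum_congr rfl fun i _ => ?_
      rw [Finset.sum_mul]
      refine Finset.sum_congr rfl fun j _ => ?_
      rw [Finset.mul_sum]
      refine Finset.sum_congr rfl fun k _ => ?_
      rw [Finset.mul_sum]
      refine Finset.sum_congr rfl fun l _ => ?_
      ring
    simp only [e, hv]
    have c : ∀ f : m → Fin k → ℝ, ∑ a, ∑ i, f i a = ∑ i, ∑ a, f i a := fun f => Finset.sum_comm
    simp only [c, Finset.sum_mul, Finset.mul_sum]
    refine Finset.sum_congr rfl fun i _ => Finset.sum_congr rfl fun j _ =>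
      Finset.sum_congr rfl fun k _ => Finset.sum_congr rfl fun l _ => ?_
    exact Finset.sum_comm
  rw [this]
  positivity

end Matrix

/-! ### Components of tensors in charts -/

section Components

variable {n : ℕ} {X : Type*} [TopologicalSpace X] [ChartedSpace (Coord n) X]

/-- The matrix of a 2-tensor in the basis of the tangent space given by the preferred chart. -/
def TwoTensor.mat (T : TwoTensor n X) (x : X) : Matrix (Fin n) (Fin n) ℝ :=
  Matrix.of fun i j => T x (EuclideanSpace.single i 1 : Coord n) (EuclideanSpace.single j 1 : Coord n)

/-- The derivative of the inverse of a chart, as an endomorphism of the model space. -/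
def chartDeriv (c : OpenPartialHomeomorph X (Coord n)) (y : Coord n) : Coord n →L[ℝ] Coord n :=
  mfderiv (𝓡 n) (𝓡 n) c.symm y

/-- The matrix whose columns are the coordinate vectors of the chart `c`. -/
def coordMatrix (c : OpenPartialHomeomorph X (Coord n)) (y : Coord n) :
    Matrix (Fin n) (Fin n) ℝ :=
  Matrix.of fun i j => chartDeriv c y (EuclideanSpace.single j 1) i

theorem coord_eq_sum (v : Coord n) : v = ∑ i, v i • (EuclideanSpace.single i 1 : Coord n) := by
  ext j
  simp [Pi.single_apply]

theorem TwoTensor.apply_eq_sum (T : TwoTensor n X) (x : X) (v w : Coord n) :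
    T x v w = ∑ i, ∑ j, v i * w j * T.mat x i j := by
  -- The tangent space is the model space by definition; the retyping lets the linearity lemmas see
  -- this.
  let B : Coord n →L[ℝ] Coord n →L[ℝ] ℝ := T x
  have h : B v w = ∑ i, ∑ j, v i * w j *
      B (EuclideanSpace.single i 1) (EuclideanSpace.single j 1) := by
    conv_lhs => rw [coord_eq_sum v, coord_eq_sum w]
    simp only [map_sum, map_smul, sum_apply, smul_apply, smul_eq_mul, Finset.mul_sum]
    rw [Finset.sum_comm]
    refine Finset.sum_congr rfl fun i _ => Finset.sum_congr rfl fun j _ => ?_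
    ring
  exact h

/-- At a given point the components in any chart are congruent to one matrix that depends only on
the point. This reduces comparisons between charts to matrix algebra. -/
theorem TwoTensor.comp_eq (T : TwoTensor n X) (c : OpenPartialHomeomorph X (Coord n))
    (y : Coord n) :
    T.comp c y = (coordMatrix c y).transpose * T.mat (c.symm y) * coordMatrix c y := by
  ext i j
  refine (T.apply_eq_sum (c.symm y) (chartDeriv c y (EuclideanSpace.single i 1))
    (chartDeriv c y (EuclideanSpace.single j 1))).trans ?_
  simp only [Matrix.mul_apply, Matrix.transpose_apply, coordMatrix, Matrix.of_apply,
    Finset.sum_mul]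
  rw [Finset.sum_comm]
  refine Finset.sum_congr rfl fun a _ => Finset.sum_congr rfl fun b _ => ?_
  ring

variable {h K : TwoTensor n X} {x : X}

theorem TwoTensor.mat_posDef (hs : ∀ v w, h x v w = h x w v) (hp : ∀ v, v ≠ 0 → 0 < h x v v) :
    (h.mat x).PosDef := by
  refine Matrix.PosDef.of_dotProduct_mulVec_pos ?_ fun v hv => ?_
  · ext i j
    exact hs _ _
  · have := hp (WithLp.toLp 2 v : Coord n) (by
      intro h0
      exact hv (by simpa using congrArg WithLp.ofLp (show (WithLp.toLp 2 v : Coord n) = 0 from h0)))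
    have this := this.trans_eq (h.apply_eq_sum x (WithLp.toLp 2 v) (WithLp.toLp 2 v))
    refine this.trans_eq ?_
    simp only [dotProduct, Matrix.mulVec, Finset.mul_sum]
    refine Finset.sum_congr rfl fun i _ => Finset.sum_congr rfl fun j _ => ?_
    simp only [Pi.star_apply, star_trivial]
    ring

variable [IsManifold (𝓡 n) ∞ X] {c c' : OpenPartialHomeomorph X (Coord n)}

theorem mdifferentiable_of_mem_atlas_smooth (hc : c ∈ atlas (Coord n) X) :
    c.MDifferentiable (𝓡 n) (𝓡 n) :=
  haveI : IsManifold (𝓡 n) 1 X := IsManifold.of_le (n := ∞) (by norm_num)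
  mdifferentiable_of_mem_atlas hc

omit [IsManifold (𝓡 n) ∞ X] in
theorem coordMatrix_eq (c : OpenPartialHomeomorph X (Coord n)) (y : Coord n) :
    coordMatrix c y = LinearMap.toMatrix (EuclideanSpace.basisFun (Fin n) ℝ).toBasis
      (EuclideanSpace.basisFun (Fin n) ℝ).toBasis (chartDeriv c y : Coord n →ₗ[ℝ] Coord n) := by
  ext i j
  simp [LinearMap.toMatrix_apply, coordMatrix]

omit [IsManifold (𝓡 n) ∞ X] in
theorem coordMatrix_det (c : OpenPartialHomeomorph X (Coord n)) (y : Coord n) :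
    (coordMatrix c y).det = (chartDeriv c y).det := by
  rw [coordMatrix_eq, LinearMap.det_toMatrix]

theorem chartDeriv_injective (hc : c ∈ atlas (Coord n) X) {y : Coord n} (hy : y ∈ c.target) :
    Function.Injective (chartDeriv c y) :=
  (mdifferentiable_of_mem_atlas_smooth hc).symm.mfderiv_injective hy

theorem coordMatrix_det_ne_zero (hc : c ∈ atlas (Coord n) X) {y : Coord n} (hy : y ∈ c.target) :
    (coordMatrix c y).det ≠ 0 := by
  rw [coordMatrix_det]
  have := (LinearMap.isUnit_iff_ker_eq_bot _).2 (LinearMap.ker_eq_bot.2 (chartDeriv_injective hc hy))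
  exact (LinearMap.isUnit_det _ this).ne_zero

theorem TwoTensor.comp_posDef (hs : ∀ x v w, h x v w = h x w v)
    (hp : ∀ x v, v ≠ 0 → 0 < h x v v) (hc : c ∈ atlas (Coord n) X) {y : Coord n}
    (hy : y ∈ c.target) : (h.comp c y).PosDef := by
  rw [h.comp_eq]
  have := TwoTensor.mat_posDef (hs (c.symm y)) (hp (c.symm y))
  have h2 := this.conjTranspose_mul_mul_same (B := coordMatrix c y)
    (Matrix.mulVec_injective_of_isUnit
      ((Matrix.isUnit_iff_isUnit_det _).2 (isUnit_iff_ne_zero.2 (coordMatrix_det_ne_zero hc hy))))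
  rwa [Matrix.conjTranspose_eq_transpose_of_trivial] at h2

theorem CoordTensor.trace_eq_metricTrace (G T : CoordTensor n) (y : Coord n) :
    CoordTensor.trace G T y = Matrix.metricTrace (G y) (T y) :=
  (Matrix.metricTrace_eq_sum _ _).symm

theorem CoordTensor.normSq_eq_metricNormSq (G T : CoordTensor n) (y : Coord n) :
    CoordTensor.normSq G T y = Matrix.metricNormSq (G y) (T y) :=
  (Matrix.metricNormSq_eq_sum _ _).symm

theorem trace_comp_eq (hc : c ∈ atlas (Coord n) X) {y : Coord n} (hy : y ∈ c.target) :
    CoordTensor.trace (h.comp c) (K.comp c) y =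
      Matrix.metricTrace (h.mat (c.symm y)) (K.mat (c.symm y)) := by
  rw [CoordTensor.trace_eq_metricTrace, h.comp_eq, K.comp_eq,
    Matrix.metricTrace_congruence (coordMatrix_det_ne_zero hc hy)]

/-- The trace computed in an arbitrary chart. -/
theorem trace_comp_eq_trace (hc : c ∈ atlas (Coord n) X) {y : Coord n} (hy : y ∈ c.target) :
    CoordTensor.trace (h.comp c) (K.comp c) y = h.trace K (c.symm y) := by
  rw [trace_comp_eq hc hy, TwoTensor.trace, trace_comp_eq (chart_mem_atlas _ _)
    (mem_chart_target _ _), OpenPartialHomeomorph.left_inv _ (mem_chart_source _ _)]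

theorem normSq_traceFree_comp_eq (hc : c ∈ atlas (Coord n) X) {y : Coord n} (hy : y ∈ c.target) :
    CoordTensor.normSq (h.comp c) (CoordTensor.traceFree (h.comp c) (K.comp c)) y =
      Matrix.metricNormSq (h.mat (c.symm y)) (K.mat (c.symm y) -
        (Matrix.metricTrace (h.mat (c.symm y)) (K.mat (c.symm y)) / n) • h.mat (c.symm y)) := by
  rw [CoordTensor.normSq_eq_metricNormSq, CoordTensor.traceFree, trace_comp_eq hc hy, h.comp_eq,
    K.comp_eq, ← Matrix.metricNormSq_congruence (g := h.mat (c.symm y))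
    (coordMatrix_det_ne_zero hc hy)]
  congr 1
  simp only [Matrix.mul_sub, Matrix.sub_mul, Matrix.mul_smul, Matrix.smul_mul]

/-- The squared norm of the trace-free part computed in an arbitrary chart. -/
theorem normSq_traceFree_comp_eq_traceFreeNormSq (hc : c ∈ atlas (Coord n) X) {y : Coord n}
    (hy : y ∈ c.target) :
    CoordTensor.normSq (h.comp c) (CoordTensor.traceFree (h.comp c) (K.comp c)) y =
      h.traceFreeNormSq K (c.symm y) := by
  rw [normSq_traceFree_comp_eq hc hy, TwoTensor.traceFreeNormSq,
    normSq_traceFree_comp_eq (chart_mem_atlas _ _)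
    (mem_chart_target _ _), OpenPartialHomeomorph.left_inv _ (mem_chart_source _ _)]

theorem TwoTensor.traceFreeNormSq_nonneg (hs : ∀ v w, h x v w = h x w v)
    (hp : ∀ v, v ≠ 0 → 0 < h x v v) : 0 ≤ h.traceFreeNormSq K x := by
  rw [TwoTensor.traceFreeNormSq, normSq_traceFree_comp_eq (chart_mem_atlas _ _)
    (mem_chart_target _ _), OpenPartialHomeomorph.left_inv _ (mem_chart_source _ _)]
  exact Matrix.metricNormSq_nonneg (mat_posDef hs hp)

/-- Chain rule for the inverses of two charts. -/
theorem chartDeriv_transition (hc : c ∈ atlas (Coord n) X) (hc' : c' ∈ atlas (Coord n) X)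
    {y : Coord n} (hy : y ∈ c'.target) (hy' : c'.symm y ∈ c.source) :
    HasFDerivAt (c ∘ c'.symm) (fderiv ℝ (c ∘ c'.symm) y) y ∧
      chartDeriv c' y = (chartDeriv c (c (c'.symm y))).comp (fderiv ℝ (c ∘ c'.symm) y) := by
  have m := mdifferentiable_of_mem_atlas_smooth hc
  have m' := mdifferentiable_of_mem_atlas_smooth hc'
  have h1 : MDifferentiableAt (𝓡 n) (𝓡 n) (c ∘ c'.symm) y :=
    (m.mdifferentiableAt hy').comp y (m'.mdifferentiableAt_symm hy)
  have h2 : DifferentiableAt ℝ (c ∘ c'.symm) y := mdifferentiableAt_iff_differentiableAt.1 h1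
  refine ⟨h2.hasFDerivAt, ?_⟩
  have h3 : mfderiv (𝓡 n) (𝓡 n) c'.symm y =
      mfderiv (𝓡 n) (𝓡 n) (c.symm ∘ (c ∘ c'.symm)) y := by
    refine Filter.EventuallyEq.mfderiv_eq ?_
    have : ∀ᶠ z in 𝓝 y, c'.symm z ∈ c.source :=
      (c'.continuousAt_symm hy).eventually (c.open_source.mem_nhds hy')
    filter_upwards [this] with z hz
    simp [hz]
  have h4 := mfderiv_comp (I := 𝓡 n) (I' := 𝓡 n) (I'' := 𝓡 n) y
    (m.mdifferentiableAt_symm (c.map_source hy') : MDifferentiableAt (𝓡 n) (𝓡 n) c.symm ((c ∘ c'.symm) y)) h1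
  rw [mfderiv_eq_fderiv] at h4
  exact h3.trans h4

end Components

/-! ### The Riemannian measure -/

section Volume

variable {n : ℕ} {X : Type*} [TopologicalSpace X] [ChartedSpace (Coord n) X]

/-- Smooth Riemannian metrics. -/
structure TwoTensor.IsRiemannian (h : TwoTensor n X) : Prop where
  symm : ∀ x v w, h x v w = h x w v
  pos : ∀ x v, v ≠ 0 → 0 < h x v v
  smooth : ∀ c ∈ atlas (Coord n) X, ∀ i j, ContDiffOn ℝ ∞ (fun y => h.comp c y i j) c.target

variable [IsManifold (𝓡 n) ∞ X] {h h' : TwoTensor n X} {c c' : OpenPartialHomeomorph X (Coord n)}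

theorem TwoTensor.IsRiemannian.comp_posDef (hh : h.IsRiemannian) (hc : c ∈ atlas (Coord n) X)
    {y : Coord n} (hy : y ∈ c.target) : (h.comp c y).PosDef :=
  TwoTensor.comp_posDef hh.symm hh.pos hc hy

theorem TwoTensor.IsRiemannian.det_pos (hh : h.IsRiemannian) (hc : c ∈ atlas (Coord n) X)
    {y : Coord n} (hy : y ∈ c.target) : 0 < (h.comp c y).det :=
  (hh.comp_posDef hc hy).det_pos

theorem TwoTensor.IsRiemannian.contDiffOn_sqrt_det (hh : h.IsRiemannian)
    (hc : c ∈ atlas (Coord n) X) :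
    ContDiffOn ℝ ∞ (fun y => Real.sqrt (h.comp c y).det) c.target :=
  (Matrix.contDiffOn_det (hh.smooth c hc)).sqrt fun _ hy => (hh.det_pos hc hy).ne'

omit [IsManifold (𝓡 n) ∞ X] in
theorem TwoTensor.IsRiemannian.mat_posDef (hh : h.IsRiemannian) (x : X) : (h.mat x).PosDef :=
  TwoTensor.mat_posDef (hh.symm x) (hh.pos x)

-- This splits the density into a Jacobian that depends only on the chart and a factor that depends
-- only on the point. The Jacobian supplies the change of variables and drops out of quotients of
-- two metrics.
omit [IsManifold (𝓡 n) ∞ X] in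
theorem TwoTensor.sqrt_det_comp (h : TwoTensor n X) (c : OpenPartialHomeomorph X (Coord n))
    (y : Coord n) : Real.sqrt (h.comp c y).det =
      |(chartDeriv c y).det| * Real.sqrt (h.mat (c.symm y)).det := by
  rw [h.comp_eq, Matrix.det_mul, Matrix.det_mul, Matrix.det_transpose, coordMatrix_det,
    mul_right_comm, Real.sqrt_mul (mul_self_nonneg _), Real.sqrt_mul_self_eq_abs]

variable [MeasurableSpace X] [BorelSpace X]

omit [ChartedSpace (Coord n) X] [IsManifold (𝓡 n) ∞ X] in
theorem measurableSet_target_inter_preimage (c : OpenPartialHomeomorph X (Coord n)) {A : Set X}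
    (hA : MeasurableSet A) : MeasurableSet (c.target ∩ c.symm ⁻¹' A) := by
  have h1 : MeasurableSet ((fun y : c.target => c.symm y) ⁻¹' A) :=
    (continuousOn_iff_continuous_domRestrict.1 c.continuousOn_symm).measurable hA
  have h2 := c.open_target.measurableSet.subtype_image h1
  convert h2 using 1
  ext y
  simp [and_comm]

omit [ChartedSpace (Coord n) X] [IsManifold (𝓡 n) ∞ X] in
theorem aemeasurable_chart_symm (c : OpenPartialHomeomorph X (Coord n)) (f : Coord n → ℝ≥0∞) :
    AEMeasurable c.symm ((volume.restrict c.target).withDensity f) :=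
  (c.continuousOn_symm.aemeasurable c.open_target.measurableSet).mono_ac
    (withDensity_absolutelyContinuous _ _)

omit [IsManifold (𝓡 n) ∞ X] in
theorem chartVolume_apply (h : TwoTensor n X) (c : OpenPartialHomeomorph X (Coord n)) {A : Set X}
    (hA : MeasurableSet A) : h.chartVolume c A =
      ∫⁻ y in c.target ∩ c.symm ⁻¹' A, ENNReal.ofReal (Real.sqrt (h.comp c y).det) := by
  rw [TwoTensor.chartVolume, Measure.map_apply_of_aemeasurable (aemeasurable_chart_symm c _) hA,
    withDensity_apply', Measure.restrict_restrict' c.open_target.measurableSet, inter_comm]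

omit [IsManifold (𝓡 n) ∞ X] in
theorem chartVolume_restrict_source (h : TwoTensor n X) (c : OpenPartialHomeomorph X (Coord n)) :
    (h.chartVolume c).restrict c.source = h.chartVolume c := by
  ext A hA
  rw [Measure.restrict_apply hA, chartVolume_apply h c hA,
    chartVolume_apply h c (hA.inter c.open_source.measurableSet)]
  congr 2
  ext y
  simp only [mem_inter_iff, mem_preimage]
  exact ⟨fun hy => ⟨hy.1, hy.2.1⟩, fun hy => ⟨hy.1, hy.2, c.map_target hy.1⟩⟩

/-- The Riemannian measures of two charts agree on the intersection of their domains. -/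
theorem chartVolume_restrict_comm (h : TwoTensor n X) (hc : c ∈ atlas (Coord n) X)
    (hc' : c' ∈ atlas (Coord n) X) :
    (h.chartVolume c').restrict c.source = (h.chartVolume c).restrict c'.source := by
  ext A hA
  have m1 := hA.inter c.open_source.measurableSet
  have m2 := hA.inter c'.open_source.measurableSet
  rw [Measure.restrict_apply hA, Measure.restrict_apply hA, chartVolume_apply h c' m1,
    chartVolume_apply h c m2]
  set S := c'.target ∩ c'.symm ⁻¹' (A ∩ c.source) with hS
  have himg : c.target ∩ c.symm ⁻¹' (A ∩ c'.source) = (c ∘ c'.symm) '' S := by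
    ext y
    simp only [hS, mem_inter_iff, mem_preimage, mem_image, Function.comp_apply]
    constructor
    · rintro ⟨hy, hyA, hy'⟩
      refine ⟨c' (c.symm y), ⟨c'.map_source hy', ?_, ?_⟩, ?_⟩
      · rwa [c'.left_inv hy']
      · rw [c'.left_inv hy']; exact c.map_target hy
      · rw [c'.left_inv hy', c.right_inv hy]
    · rintro ⟨z, ⟨hz, hzA, hzc⟩, rfl⟩
      refine ⟨c.map_source hzc, ?_, ?_⟩
      · rwa [c.left_inv hzc]
      · rw [c.left_inv hzc]; exact c'.map_target hz
  have hderiv : ∀ z ∈ S, HasFDerivWithinAt (c ∘ c'.symm) (fderiv ℝ (c ∘ c'.symm) z) S z :=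
    fun z hz => (chartDeriv_transition hc hc' hz.1 hz.2.2).1.hasFDerivWithinAt
  have hinj : InjOn (c ∘ c'.symm) S := by
    intro z hz w hw hzw
    exact c'.symm.injOn hz.1 hw.1 (c.injOn hz.2.2 hw.2.2 hzw)
  rw [himg, lintegral_image_eq_lintegral_abs_det_fderiv_mul volume
    (measurableSet_target_inter_preimage c' m1) hderiv hinj]
  refine setLIntegral_congr_fun (measurableSet_target_inter_preimage c' m1) fun z hz => ?_
  -- Both densities contain the same pointwise factor; their Jacobians differ by that of the
  -- transition map, which is the change of variables factor.
  rw [← ENNReal.ofReal_mul (abs_nonneg _), h.sqrt_det_comp, h.sqrt_det_comp,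
    (chartDeriv_transition hc hc' hz.1 hz.2.2).2, Function.comp_apply, c.left_inv hz.2.2,
    ContinuousLinearMap.det, ContinuousLinearMap.toLinearMap_comp, LinearMap.det_comp, abs_mul,
    mul_comm |LinearMap.det _|, mul_assoc]

/-- On the domain of a chart, the Riemannian measure is given by `√(det h_ij) dy`. -/
theorem volumeMeasure_restrict_source (h : TwoTensor n X) (hc : c ∈ atlas (Coord n) X) :
    h.volumeMeasure.restrict c.source = h.chartVolume c := by
  apply le_antisymm
  -- Each chart measure in the supremum is split along `c.source`: the part inside is dominated by
  -- the measure of `c` by compatibility, and the part outside disappears after restriction.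
  · have hle : h.volumeMeasure ≤ h.chartVolume c + h.volumeMeasure.restrict c.sourceᶜ := by
      refine iSup₂_le fun c' hc' => ?_
      rw [← Measure.restrict_add_restrict_compl (μ := h.chartVolume c')
        c.open_source.measurableSet, chartVolume_restrict_comm h hc hc']
      refine add_le_add Measure.restrict_le_self (Measure.restrict_mono le_rfl ?_)
      exact le_iSup₂_of_le c' hc' le_rfl
    refine (Measure.restrict_mono le_rfl hle).trans ?_
    rw [Measure.restrict_add, Measure.restrict_restrict c.open_source.measurableSet,
      inter_compl_self, Measure.restrict_empty, add_zero, chartVolume_restrict_source]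
  · rw [← chartVolume_restrict_source]
    exact Measure.restrict_mono le_rfl (le_iSup₂_of_le c hc le_rfl)

omit [MeasurableSpace X] [BorelSpace X] in
theorem TwoTensor.IsRiemannian.aemeasurable_sqrt_det (hh : h.IsRiemannian)
    (hc : c ∈ atlas (Coord n) X) :
    AEMeasurable (fun y => ENNReal.ofReal (Real.sqrt (h.comp c y).det))
      (volume.restrict c.target) :=
  ((hh.contDiffOn_sqrt_det hc).continuousOn.aemeasurable
    c.open_target.measurableSet).ennreal_ofReal

theorem setLIntegral_chartVolume (hh : h.IsRiemannian) (hc : c ∈ atlas (Coord n) X)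
    {f : X → ℝ≥0∞} (hf : Measurable f) {A : Set X} (hA : MeasurableSet A) :
    ∫⁻ x in A, f x ∂(h.chartVolume c) = ∫⁻ y in c.target ∩ c.symm ⁻¹' A,
      ENNReal.ofReal (Real.sqrt (h.comp c y).det) * f (c.symm y) := by
  have hd := hh.aemeasurable_sqrt_det hc
  rw [← lintegral_indicator hA, TwoTensor.chartVolume,
    lintegral_map' (hf.indicator hA).aemeasurable (aemeasurable_chart_symm c _),
    lintegral_withDensity_eq_lintegral_mul₀' hd (g := fun y => A.indicator f (c.symm y))
      ((hf.indicator hA).comp_aemeasurable (aemeasurable_chart_symm c _)),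
    ← inter_comm, ← Measure.restrict_restrict' c.open_target.measurableSet]
  have hm : NullMeasurableSet (c.symm ⁻¹' A) (volume.restrict c.target) :=
    (c.continuousOn_symm.aemeasurable c.open_target.measurableSet).nullMeasurableSet_preimage hA
  rw [← lintegral_indicator₀ hm]
  refine lintegral_congr fun y => ?_
  by_cases hy : c.symm y ∈ A
  · simp [indicator, hy]
  · simp [indicator, hy]

/-- A compact neighborhood inside the chart image has finite volume because the density is
continuous there. On a compact manifold this makes the measure finite and continuous functions
integrable. -/
theorem TwoTensor.IsRiemannian.isLocallyFiniteMeasure (hh : h.IsRiemannian) :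
    IsLocallyFiniteMeasure h.volumeMeasure := by
  refine ⟨fun x => ?_⟩
  set c := chartAt (Coord n) x with hcdef
  have hc : c ∈ atlas (Coord n) X := chart_mem_atlas _ _
  obtain ⟨K, hKc, hKx, hKt⟩ : ∃ K, IsCompact K ∧ c x ∈ interior K ∧ K ⊆ c.target :=
    exists_compact_subset c.open_target (mem_chart_target _ x)
  have hU : IsOpen (c.source ∩ c ⁻¹' interior K) :=
    c.continuousOn.isOpen_inter_preimage c.open_source isOpen_interior
  refine ⟨c.source ∩ c ⁻¹' interior K, hU.mem_nhds ⟨mem_chart_source _ x, hKx⟩, ?_⟩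
  have e : h.volumeMeasure (c.source ∩ c ⁻¹' interior K) =
      h.chartVolume c (c.source ∩ c ⁻¹' interior K) := by
    rw [← volumeMeasure_restrict_source h hc, Measure.restrict_apply hU.measurableSet]
    congr 1
    ext z; simp only [mem_inter_iff]; tauto
  rw [e, chartVolume_apply h c hU.measurableSet]
  have hsub : c.target ∩ c.symm ⁻¹' (c.source ∩ c ⁻¹' interior K) ⊆ K := by
    rintro y ⟨hy, -, hy2⟩
    have := interior_subset hy2
    rwa [c.right_inv hy] at this
  refine (lintegral_mono_set hsub).trans_lt ?_
  have hi : IntegrableOn (fun y => Real.sqrt (h.comp c y).det) K :=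
    ((hh.contDiffOn_sqrt_det hc).continuousOn.mono hKt).integrableOn_compact hKc
  exact hi.lintegral_lt_top

omit [IsManifold (𝓡 n) ∞ X] [BorelSpace X] in
/-- Two measures on a compact manifold that agree on the chart domains are equal. -/
theorem measure_ext_of_chart_restrict [CompactSpace X] {μ ν : Measure X}
    (H : ∀ c ∈ atlas (Coord n) X, μ.restrict c.source = ν.restrict c.source) : μ = ν := by
  obtain ⟨s, hs, hcov⟩ := countable_cover_nhds_of_sigmaCompact
    (f := fun x : X => (chartAt (Coord n) x).source) fun x => chart_source_mem_nhds _ x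
  exact Measure.ext_of_biUnion_eq_univ hs hcov fun x _ => H _ (chart_mem_atlas _ x)

/-- The Jacobian of the chart cancels in the quotient of the two densities, so the local quotients
are one global function. All the measures of the flow can thus be referred to a fixed one. -/
theorem volumeMeasure_eq_withDensity [CompactSpace X] (hh : h.IsRiemannian)
    (hm : Measurable fun x => Real.sqrt ((h'.mat x).det / (h.mat x).det)) :
    h'.volumeMeasure = h.volumeMeasure.withDensity
      (fun x => ENNReal.ofReal (Real.sqrt ((h'.mat x).det / (h.mat x).det))) := by
  refine measure_ext_of_chart_restrict (n := n) fun c hc => ?_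
  have mc := c.open_source.measurableSet
  rw [restrict_withDensity mc, volumeMeasure_restrict_source h hc,
    volumeMeasure_restrict_source h' hc]
  ext A hA
  rw [withDensity_apply _ hA, setLIntegral_chartVolume hh hc hm.ennreal_ofReal hA,
    chartVolume_apply h' c hA]
  refine setLIntegral_congr_fun (measurableSet_target_inter_preimage c hA) fun y hy => ?_
  rw [← ENNReal.ofReal_mul (Real.sqrt_nonneg _), h.sqrt_det_comp, h'.sqrt_det_comp, mul_assoc,
    ← Real.sqrt_mul (hh.mat_posDef _).det_pos.le,
    mul_div_cancel₀ _ (hh.mat_posDef _).det_pos.ne']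

/-- Integration over the domain of a chart. -/
theorem setIntegral_source_eq (hh : h.IsRiemannian) (hc : c ∈ atlas (Coord n) X) {f : X → ℝ}
    (hf : AEStronglyMeasurable f (h.volumeMeasure.restrict c.source)) :
    ∫ x in c.source, f x ∂h.volumeMeasure =
      ∫ y in c.target, Real.sqrt (h.comp c y).det * f (c.symm y) := by
  rw [volumeMeasure_restrict_source h hc] at hf ⊢
  rw [TwoTensor.chartVolume] at hf ⊢
  rw [integral_map (aemeasurable_chart_symm c _) hf,
    integral_withDensity_eq_integral_toReal_smul₀ (hh.aemeasurable_sqrt_det hc)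
      (Eventually.of_forall fun _ => ENNReal.ofReal_lt_top)]
  refine integral_congr_ae (Eventually.of_forall fun y => ?_)
  simp [ENNReal.toReal_ofReal, Real.sqrt_nonneg]

theorem integrableOn_source_iff (hh : h.IsRiemannian) (hc : c ∈ atlas (Coord n) X) {f : X → ℝ}
    (hf : AEStronglyMeasurable f (h.volumeMeasure.restrict c.source)) :
    IntegrableOn f c.source h.volumeMeasure ↔
      IntegrableOn (fun y => Real.sqrt (h.comp c y).det * f (c.symm y)) c.target := by
  rw [IntegrableOn, IntegrableOn]
  rw [volumeMeasure_restrict_source h hc] at hf ⊢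
  rw [TwoTensor.chartVolume] at hf ⊢
  rw [integrable_map_measure hf (aemeasurable_chart_symm c _),
    integrable_withDensity_iff_integrable_smul₀' (hh.aemeasurable_sqrt_det hc)
      (Eventually.of_forall fun _ => ENNReal.ofReal_lt_top)]
  refine integrable_congr (Eventually.of_forall fun y => ?_)
  simp [ENNReal.toReal_ofReal, Real.sqrt_nonneg]

end Volume

/-! ### The Laplacian in coordinates -/

namespace CoordTensor

variable {n : ℕ} {U : Set (Coord n)} {f : Coord n → ℝ} {y : Coord n}

theorem contDiffOn_pderiv (hU : IsOpen U) (hf : ContDiffOn ℝ ∞ f U) (k : Fin n) :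
    ContDiffOn ℝ ∞ (pderiv k f) U :=
  (hf.fderiv_of_isOpen hU (m := ∞) (by norm_num)).clm_apply contDiffOn_const

theorem differentiableAt_of_contDiffOn (hU : IsOpen U) (hf : ContDiffOn ℝ ∞ f U) (hy : y ∈ U) :
    DifferentiableAt ℝ f y :=
  (hf.contDiffAt (hU.mem_nhds hy)).differentiableAt (by norm_num)

theorem fderiv_eq_sum_pderiv (f : Coord n → ℝ) (y v : Coord n) :
    fderiv ℝ f y v = ∑ i, v i * pderiv i f y := by
  conv_lhs => rw [coord_eq_sum v]
  simp [pderiv]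

theorem hasDerivAt_line (hf : DifferentiableAt ℝ f y) (v : Coord n) :
    HasDerivAt (fun σ : ℝ => f (y + σ • v)) (fderiv ℝ f y v) 0 := by
  simpa [HasLineDerivAt] using hf.hasFDerivAt.hasLineDerivAt v

theorem hasDerivAt_coord_line (hf : DifferentiableAt ℝ f y) (k : Fin n) :
    HasDerivAt (fun σ : ℝ => f (y + σ • EuclideanSpace.single k 1)) (pderiv k f y) 0 :=
  hasDerivAt_line hf _

/-- The contraction `g^ik Γ^j_ik` in terms of the derivatives `D_i = ∂_i g`. -/
theorem contracted_christoffel {P : Matrix (Fin n) (Fin n) ℝ}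
    {D : Fin n → Matrix (Fin n) (Fin n) ℝ} (hP : ∀ i j, P i j = P j i)
    (hD : ∀ k i j, D k i j = D k j i) (j : Fin n) :
    ∑ i, ((1 / 2) * Matrix.trace (P * D i) * P i j - (P * D i * P) i j) =
      -∑ i, ∑ k, P i k * ((1 / 2) * ∑ l, P j l * (D i k l + D k i l - D l i k)) := by
  have e1 : ∑ i, (P * D i * P) i j = ∑ i, ∑ k, ∑ l, P i k * P j l * D i k l := by
    refine Finset.sum_congr rfl fun i _ => ?_
    simp only [Matrix.mul_apply, Finset.sum_mul]
    rw [Finset.sum_comm]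
    refine Finset.sum_congr rfl fun k _ => Finset.sum_congr rfl fun l _ => ?_
    rw [hP l j]; ring
  have e2 : ∑ i, ∑ k, ∑ l, P i k * P j l * D k i l = ∑ i, ∑ k, ∑ l, P i k * P j l * D i k l := by
    rw [Finset.sum_comm]
    refine Finset.sum_congr rfl fun i _ => Finset.sum_congr rfl fun k _ =>
      Finset.sum_congr rfl fun l _ => ?_
    rw [hP k i]
  have e3 : ∑ l, Matrix.trace (P * D l) * P l j = ∑ i, ∑ k, ∑ l, P i k * P j l * D l i k := by
    simp only [Matrix.trace, Matrix.diag_apply, Matrix.mul_apply, Finset.sum_mul]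
    rw [Finset.sum_comm]
    refine Finset.sum_congr rfl fun i _ => ?_
    rw [Finset.sum_comm]
    refine Finset.sum_congr rfl fun k _ => Finset.sum_congr rfl fun l _ => ?_
    rw [hP l j, hD l k i]; ring
  have e4 : ∑ i, ∑ k, P i k * ((1 / 2) * ∑ l, P j l * (D i k l + D k i l - D l i k)) =
      (1 / 2) * (∑ i, ∑ k, ∑ l, P i k * P j l * D i k l + ∑ i, ∑ k, ∑ l, P i k * P j l * D k i l
        - ∑ i, ∑ k, ∑ l, P i k * P j l * D l i k) := by
    simp only [← Finset.sum_add_distrib, ← Finset.sum_sub_distrib, Finset.mul_sum]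
    refine Finset.sum_congr rfl fun i _ => Finset.sum_congr rfl fun k _ =>
      Finset.sum_congr rfl fun l _ => ?_
    ring
  rw [e4, e2, ← e3, ← e1, Finset.sum_sub_distrib]
  simp only [mul_assoc]
  rw [← Finset.mul_sum]
  ring

variable {G : CoordTensor n}

/-- The trace of the Hessian, `h^ij f_{;ij}`. -/
def laplacian (G : CoordTensor n) (f : Coord n → ℝ) (y : Coord n) : ℝ :=
  ∑ i, ∑ j, (G y)⁻¹ i j * hessian G f i j y

/-- The vector density `√(det h) h^ij ∂_j f`. -/
def gradDensity (G : CoordTensor n) (f : Coord n → ℝ) (i : Fin n) (y : Coord n) : ℝ :=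
  Real.sqrt (G y).det * ∑ j, (G y)⁻¹ i j * pderiv j f y

theorem contDiffOn_gradDensity (hU : IsOpen U) (hG : ∀ i j, ContDiffOn ℝ ∞ (fun z => G z i j) U)
    (hpos : ∀ z ∈ U, (G z).PosDef) (hf : ContDiffOn ℝ ∞ f U) (i : Fin n) :
    ContDiffOn ℝ ∞ (gradDensity G f i) U := by
  refine ((Matrix.contDiffOn_det hG).sqrt fun z hz => (hpos z hz).det_pos.ne').mul ?_
  refine ContDiffOn.sum fun j _ => ?_
  exact (Matrix.contDiffOn_inv_apply hG (fun z hz => (hpos z hz).det_pos.ne') i j).mul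
    (contDiffOn_pderiv hU hf j)

/-- The Laplacian in divergence form. -/
theorem sum_pderiv_gradDensity (hU : IsOpen U) (hG : ∀ i j, ContDiffOn ℝ ∞ (fun z => G z i j) U)
    (hpos : ∀ z ∈ U, (G z).PosDef) (hf : ContDiffOn ℝ ∞ f U) (hy : y ∈ U) :
    ∑ i, pderiv i (gradDensity G f i) y = Real.sqrt (G y).det * laplacian G f y := by
  have hdet := (hpos y hy).det_pos
  have hdG : ∀ i j, DifferentiableAt ℝ (fun z => G z i j) y := fun i j =>
    differentiableAt_of_contDiffOn hU (hG i j) hy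
  let D : Fin n → Matrix (Fin n) (Fin n) ℝ := fun k =>
    Matrix.of fun i j => pderiv k (fun z => G z i j) y
  set P := (G y)⁻¹ with hP
  have hPs : ∀ i j, P i j = P j i := fun i j => by
    simpa using (hpos y hy).inv.isHermitian.apply j i
  have hDs : ∀ k i j, D k i j = D k j i := fun k i j => by
    simp only [D, Matrix.of_apply, pderiv]
    congr 1
    refine Filter.EventuallyEq.fderiv_eq ?_
    filter_upwards [hU.mem_nhds hy] with z hz
    simpa using (hpos z hz).isHermitian.apply j i
  have step : ∀ i, pderiv i (gradDensity G f i) y = Real.sqrt (G y).det *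
      (∑ j, ((1 / 2) * Matrix.trace (P * D i) * P i j - (P * D i * P) i j) * pderiv j f y +
        ∑ j, P i j * pderiv i (pderiv j f) y) := by
    intro i
    -- The partial derivative is taken along a coordinate line, where the one-variable formulas for
    -- the determinant and the inverse matrix apply.
    have hline := hasDerivAt_coord_line
      (differentiableAt_of_contDiffOn hU (contDiffOn_gradDensity hU hG hpos hf i) hy) i
    have hA : ∀ a b, HasDerivWithinAt
        (fun σ : ℝ => G (y + σ • EuclideanSpace.single i 1) a b) (D i a b) univ 0 := fun a b =>
      (hasDerivAt_coord_line (hdG a b) i).hasDerivWithinAt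
    have h0 : y + (0 : ℝ) • (EuclideanSpace.single i 1 : Coord n) = y := by simp
    have hd1 := hasDerivWithinAt_univ.1 (Matrix.hasDerivWithinAt_det hA)
    have hd2 := fun j => hasDerivWithinAt_univ.1
      (Matrix.hasDerivWithinAt_inv hA (by rw [h0]; exact hdet.ne') i j)
    have hd3 := fun j => hasDerivAt_coord_line
      (differentiableAt_of_contDiffOn hU (contDiffOn_pderiv hU hf j) hy) i
    have hd := (hd1.sqrt (by simpa only [h0] using hdet.ne')).fun_mul
      (HasDerivAt.fun_sum (u := Finset.univ) fun j _ => (hd2 j).fun_mul (hd3 j))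
    rw [hline.unique hd]
    simp only [h0, Matrix.adjugate_eq_det_smul_inv hdet.ne', ← hP]
    have hs : Real.sqrt (G y).det ≠ 0 := (Real.sqrt_pos.2 hdet).ne'
    have hs2 : (G y).det = Real.sqrt (G y).det * Real.sqrt (G y).det :=
      (Real.mul_self_sqrt hdet.le).symm
    rw [Matrix.smul_mul, Matrix.trace_smul, smul_eq_mul]
    have e : (G y).det * Matrix.trace (P * D i) / (2 * Real.sqrt (G y).det) =
        Real.sqrt (G y).det * ((1 / 2) * Matrix.trace (P * D i)) := by
      rw [hs2, Real.sqrt_mul_self (Real.sqrt_nonneg _)]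
      field_simp
    rw [e, mul_assoc, ← mul_add]
    congr 1
    rw [Finset.mul_sum, ← Finset.sum_add_distrib, ← Finset.sum_add_distrib]
    refine Finset.sum_congr rfl fun j _ => ?_
    rw [Matrix.neg_apply]
    ring
  simp only [step]
  rw [← Finset.mul_sum, laplacian]
  congr 1
  rw [Finset.sum_add_distrib, Finset.sum_comm]
  simp only [← Finset.sum_mul]
  simp only [contracted_christoffel hPs hDs]
  have e : ∑ j, (-∑ i, ∑ k, P i k * ((1 / 2) * ∑ l, P j l * (D i k l + D k i l - D l i k))) *
      pderiv j f y = -∑ i, ∑ j, P i j * ∑ k, christoffel G k i j y * pderiv k f y := by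
    simp only [neg_mul, Finset.sum_neg_distrib, Finset.sum_mul, Finset.mul_sum]
    rw [Finset.sum_comm]
    congr 1
    refine Finset.sum_congr rfl fun i _ => ?_
    rw [Finset.sum_comm]
    refine Finset.sum_congr rfl fun k _ => Finset.sum_congr rfl fun j _ => ?_
    simp only [christoffel, ← hP, Finset.mul_sum, Finset.sum_mul, D, Matrix.of_apply]
    refine Finset.sum_congr rfl fun l _ => ?_
    ring
  rw [e]
  simp only [hessian, mul_sub, Finset.sum_sub_distrib, ← hP]
  ring

/-- The second derivative test: a necessary condition. -/
theorem _root_.IsLocalMax.deriv_deriv_nonpos {g : ℝ → ℝ} {a : ℝ} (hg : IsLocalMax g a)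
    (hc : ContinuousAt g a) : deriv (deriv g) a ≤ 0 := by
  by_contra hlt
  -- A positive second derivative would make the point a local minimum too, so the function would be
  -- locally constant and its second derivative zero.
  have hmin := isLocalMin_of_deriv_deriv_pos (not_le.1 hlt) hg.deriv_eq_zero hc
  have hconst : g =ᶠ[𝓝 a] fun _ => g a := by
    filter_upwards [hg, hmin] with z h1 h2 using le_antisymm h1 h2
  have h1 : deriv g =ᶠ[𝓝 a] fun _ => 0 := by
    simpa using hconst.deriv
  exact hlt (by simpa using h1.deriv_eq.le)

/-- At a local maximum the Laplacian is nonpositive. -/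
theorem laplacian_nonpos_of_isLocalMax (hU : IsOpen U) (hpos : (G y).PosDef)
    (hf : ContDiffOn ℝ ∞ f U) (hy : y ∈ U) (hmax : IsLocalMax f y) : laplacian G f y ≤ 0 := by
  -- The gradient vanishes at the maximum, so the Christoffel terms of the Hessian drop out.
  have hgrad : ∀ k, pderiv k f y = 0 := fun k => by
    simp [pderiv, hmax.fderiv_eq_zero]
  have hdir : ∀ v : Coord n, ∑ i, ∑ j, v i * v j * pderiv i (pderiv j f) y ≤ 0 := by
    intro v
    have hcont : Continuous fun σ : ℝ => y + σ • v := by fun_prop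
    have htend : Tendsto (fun σ : ℝ => y + σ • v) (𝓝 0) (𝓝 y) := by
      simpa using hcont.tendsto 0
    have hlm : IsLocalMax (fun σ : ℝ => f (y + σ • v)) 0 := by
      have := htend.eventually hmax
      filter_upwards [this] with σ hσ
      simpa using hσ
    have hca : ContinuousAt (fun σ : ℝ => f (y + σ • v)) 0 :=
      (hasDerivAt_line (differentiableAt_of_contDiffOn hU hf hy) v).continuousAt
    have hd1 : deriv (fun σ : ℝ => f (y + σ • v)) =ᶠ[𝓝 0]
        fun σ => ∑ j, v j * pderiv j f (y + σ • v) := by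
      filter_upwards [htend.eventually (hU.mem_nhds hy)] with σ hσ
      have hd := differentiableAt_of_contDiffOn hU hf hσ
      have hl : HasDerivAt (fun σ : ℝ => y + σ • v) v σ := by
        simpa using ((hasDerivAt_id σ).smul_const v).const_add y
      exact (hd.hasFDerivAt.comp_hasDerivAt σ hl).deriv.trans (fderiv_eq_sum_pderiv _ _ _)
    have hd2 : HasDerivAt (fun σ : ℝ => ∑ j, v j * pderiv j f (y + σ • v))
        (∑ j, v j * fderiv ℝ (pderiv j f) y v) 0 :=
      HasDerivAt.fun_sum fun j _ => (hasDerivAt_line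
        (differentiableAt_of_contDiffOn hU (contDiffOn_pderiv hU hf j) hy) v).const_mul _
    have := hlm.deriv_deriv_nonpos hca
    rw [hd1.deriv_eq, hd2.deriv] at this
    refine le_trans (le_of_eq ?_) this
    simp only [fderiv_eq_sum_pderiv _ y v, Finset.mul_sum]
    rw [Finset.sum_comm]
    refine Finset.sum_congr rfl fun i _ => Finset.sum_congr rfl fun j _ => ?_
    ring
  -- The inverse metric is a sum of squares `v_a v_aᵀ`, so the Laplacian is a sum of second
  -- derivatives in the directions `v_a`.
  obtain ⟨m, v, hv⟩ := hpos.inv.posSemidef.exists_eq_transpose_mul_self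
  have : laplacian G f y = ∑ a, ∑ i, ∑ j, v a i * v a j * pderiv i (pderiv j f) y := by
    simp only [laplacian, hessian, hgrad, mul_zero, Finset.sum_const_zero, sub_zero, hv,
      Finset.sum_mul]
    have e : ∀ φ : Fin n → Fin m → ℝ, ∑ i, ∑ a, φ i a = ∑ a, ∑ i, φ i a := fun φ =>
      Finset.sum_comm
    simp only [e]
  rw [this]
  exact Finset.sum_nonpos fun a _ => hdir (WithLp.toLp 2 (v a))

end CoordTensor

/-! ### The divergence theorem -/

section Divergence

open CoordTensor

variable {n : ℕ}

/-- Integration by parts against a function with compact support in an open set. -/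
theorem integral_pderiv_mul_compactSupport {U K : Set (Coord n)} (hU : IsOpen U)
    (hK : IsCompact K) (hKU : K ⊆ U) {χ V : Coord n → ℝ} (hχ : ContDiffOn ℝ ∞ χ U)
    (hχ0 : ∀ y ∉ K, χ y = 0) (hV : ContDiffOn ℝ ∞ V U) (i : Fin n) :
    Integrable (fun y => χ y * pderiv i V y) ∧ Integrable (fun y => pderiv i χ y * V y) ∧
      ∫ y, χ y * pderiv i V y = - ∫ y, pderiv i χ y * V y := by
  have hnear : ∀ y ∉ K, χ =ᶠ[𝓝 y] fun _ => 0 := fun y hy => by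
    filter_upwards [hK.isClosed.isOpen_compl.mem_nhds hy] with z hz using hχ0 z hz
  have hdiff : ∀ y, DifferentiableAt ℝ χ y := fun y => by
    by_cases hy : y ∈ U
    · exact differentiableAt_of_contDiffOn hU hχ hy
    · exact (differentiableAt_const 0).congr_of_eventuallyEq (hnear y fun h => hy (hKU h))
  have hpd0 : ∀ y ∉ K, pderiv i χ y = 0 := fun y hy => by
    simp [pderiv, (hnear y hy).fderiv_eq]
  -- Nothing is known about `V` outside `U`; every integrand is controlled on `K` by continuity and
  -- vanishes elsewhere.
  have hint : ∀ F : Coord n → ℝ, ContinuousOn F U → (∀ y ∉ K, F y = 0) → Integrable F := by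
    intro F hF h0
    refine (integrableOn_iff_integrable_of_support_subset (s := K) ?_).1
      ((hF.mono hKU).integrableOn_compact hK)
    intro y hy
    by_contra h
    exact hy (h0 y h)
  have i1 : Integrable (fun y => χ y * pderiv i V y) :=
    hint _ (hχ.continuousOn.mul (contDiffOn_pderiv hU hV i).continuousOn)
      fun y hy => by simp [hχ0 y hy]
  have i2 : Integrable (fun y => pderiv i χ y * V y) :=
    hint _ ((contDiffOn_pderiv hU hχ i).continuousOn.mul hV.continuousOn)
      fun y hy => by simp [hpd0 y hy]
  have i3 : Integrable (fun y => χ y * V y) :=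
    hint _ (hχ.continuousOn.mul hV.continuousOn) fun y hy => by simp [hχ0 y hy]
  refine ⟨i1, i2, ?_⟩
  refine integral_mul_fderiv_eq_neg_fderiv_mul_of_integrable i2 i1 i3 (fun y _ => hdiff y) ?_
  intro y hy
  have : y ∈ K := closure_minimal (fun z hz => by
    by_contra h
    exact hz (hχ0 z h)) hK.isClosed hy
  exact differentiableAt_of_contDiffOn hU hV (hKU this)

/-- Covectors transform by `Jᵀ` and the inverse metric by the inverse congruence. This makes the
inner product of two differentials computable in any chart. -/
theorem Matrix.dotProduct_inv_mulVec_congruence {g J : Matrix (Fin n) (Fin n) ℝ}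
    (hJ : J.det ≠ 0) (u w : Fin n → ℝ) :
    (J.transpose.mulVec u) ⬝ᵥ ((J.transpose * g * J)⁻¹.mulVec (J.transpose.mulVec w)) =
      u ⬝ᵥ (g⁻¹.mulVec w) := by
  have h1 : J * J⁻¹ = 1 := Matrix.mul_nonsing_inv _ (isUnit_iff_ne_zero.2 hJ)
  have h2 : (J.transpose)⁻¹ * J.transpose = 1 :=
    Matrix.nonsing_inv_mul _ (isUnit_iff_ne_zero.2 (by simpa using hJ))
  rw [Matrix.mul_inv_rev, Matrix.mul_inv_rev, Matrix.mulVec_mulVec, Matrix.mulVec_transpose,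
    ← Matrix.dotProduct_mulVec, Matrix.mulVec_mulVec]
  congr 2
  calc J * (J⁻¹ * (g⁻¹ * J.transpose⁻¹) * J.transpose)
      = (J * J⁻¹) * g⁻¹ * (J.transpose⁻¹ * J.transpose) := by simp only [Matrix.mul_assoc]
    _ = g⁻¹ := by rw [h1, h2, Matrix.one_mul, Matrix.mul_one]

variable {X : Type*} [TopologicalSpace X] [ChartedSpace (Coord n) X]

/-- The components of the differential in the basis given by the preferred chart. -/
def differential (f : X → ℝ) (x : X) (i : Fin n) : ℝ :=
  (mfderiv (𝓡 n) 𝓘(ℝ, ℝ) f x : Coord n →L[ℝ] ℝ) (EuclideanSpace.single i 1)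

/-- The inner product of the differentials of two functions. -/
def gradInner (h : TwoTensor n X) (f g : X → ℝ) (x : X) : ℝ :=
  differential f x ⬝ᵥ ((h.mat x)⁻¹.mulVec (differential g x))

/-- Smoothness of a function in all charts of the atlas. -/
def SmoothInCharts (n : ℕ) {X : Type*} [TopologicalSpace X] [ChartedSpace (Coord n) X]
    (f : X → ℝ) : Prop :=
  ∀ c ∈ atlas (Coord n) X, ContDiffOn ℝ ∞ (fun y => f (c.symm y)) c.target

variable [IsManifold (𝓡 n) ∞ X] {h : TwoTensor n X} {c : OpenPartialHomeomorph X (Coord n)}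
  {f g χ D : X → ℝ}

theorem ContMDiff.smoothInCharts (hf : ContMDiff (𝓡 n) 𝓘(ℝ, ℝ) ∞ f) : SmoothInCharts n f := by
  intro c hc
  have h1 : ContMDiffOn (𝓡 n) (𝓡 n) ∞ c.symm c.target :=
    contMDiffOn_symm_of_mem_maximalAtlas (IsManifold.subset_maximalAtlas hc)
  exact (hf.comp_contMDiffOn h1).contDiffOn

theorem SmoothInCharts.mdifferentiableAt (hf : SmoothInCharts n f) (x : X) :
    MDifferentiableAt (𝓡 n) 𝓘(ℝ, ℝ) f x := by
  set c := chartAt (Coord n) x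
  have hc : c ∈ atlas (Coord n) X := chart_mem_atlas _ _
  have hx : x ∈ c.source := mem_chart_source _ _
  have h1 : DifferentiableAt ℝ (fun y => f (c.symm y)) (c x) :=
    differentiableAt_of_contDiffOn c.open_target (hf c hc) (c.map_source hx)
  have h2 := (mdifferentiableAt_iff_differentiableAt.2 h1).comp x
    ((mdifferentiable_of_mem_atlas_smooth hc).mdifferentiableAt hx)
  refine h2.congr_of_eventuallyEq ?_
  filter_upwards [c.open_source.mem_nhds hx] with z hz
  simp [hz]

theorem SmoothInCharts.pderiv_eq (hf : SmoothInCharts n f) (hc : c ∈ atlas (Coord n) X)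
    {y : Coord n} (hy : y ∈ c.target) :
    (fun i => pderiv i (fun z => f (c.symm z)) y) =
      (coordMatrix c y).transpose.mulVec (differential f (c.symm y)) := by
  ext i
  have h1 := mfderiv_comp (I := 𝓡 n) (I' := 𝓡 n) (I'' := 𝓘(ℝ, ℝ)) y
    (hf.mdifferentiableAt (c.symm y))
    ((mdifferentiable_of_mem_atlas_smooth hc).mdifferentiableAt_symm hy)
  rw [mfderiv_eq_fderiv] at h1
  let B : Coord n →L[ℝ] ℝ := mfderiv (𝓡 n) 𝓘(ℝ, ℝ) f (c.symm y)
  have h2 : fderiv ℝ (fun z => f (c.symm z)) y = B.comp (chartDeriv c y) := h1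
  rw [pderiv, h2, ContinuousLinearMap.comp_apply,
    coord_eq_sum (chartDeriv c y (EuclideanSpace.single i 1))]
  simp only [map_sum, map_smul, smul_eq_mul]
  rfl

theorem gradInner_eq (hf : SmoothInCharts n f) (hg : SmoothInCharts n g)
    (hc : c ∈ atlas (Coord n) X) {y : Coord n} (hy : y ∈ c.target) :
    gradInner h f g (c.symm y) = ∑ i, pderiv i (fun z => f (c.symm z)) y *
      ∑ j, (h.comp c y)⁻¹ i j * pderiv j (fun z => g (c.symm z)) y := by
  rw [gradInner, ← Matrix.dotProduct_inv_mulVec_congruence (coordMatrix_det_ne_zero hc hy),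
    ← hf.pderiv_eq hc hy, ← hg.pderiv_eq hc hy, ← h.comp_eq]
  rfl

omit [IsManifold (𝓡 n) ∞ X] in
theorem gradInner_eq_zero_of_notMem_tsupport {x : X} (hx : x ∉ tsupport χ) :
    gradInner h χ f x = 0 := by
  have h1 : χ =ᶠ[𝓝 x] fun _ => 0 := notMem_tsupport_iff_eventuallyEq.1 hx
  have h2 : (mfderiv (𝓡 n) 𝓘(ℝ, ℝ) χ x : Coord n →L[ℝ] ℝ) = 0 := by
    rw [h1.mfderiv_eq]; exact mfderiv_const
  have : (differential χ x : Fin n → ℝ) = 0 := by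
    ext i
    simp only [differential]
    rw [h2]
    rfl
  rw [gradInner, this, zero_dotProduct]

variable [MeasurableSpace X] [BorelSpace X] [CompactSpace X] [T2Space X]

omit [T2Space X] in
/-- The integral of `div (χ ∇f)` vanishes if the support of `χ` lies in a chart domain. -/
theorem integral_div_chart (hh : h.IsRiemannian) (hf : SmoothInCharts n f)
    (hχ : SmoothInCharts n χ) (hχcont : Continuous χ) (hc : c ∈ atlas (Coord n) X)
    (hsupp : tsupport χ ⊆ c.source)
    (hDcont : Continuous D)
    (hD : ∀ y ∈ c.target, D (c.symm y) = laplacian (h.comp c) (fun z => f (c.symm z)) y) :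
    Integrable (gradInner h χ f) h.volumeMeasure ∧
      ∫ x, χ x * D x ∂h.volumeMeasure = - ∫ x, gradInner h χ f x ∂h.volumeMeasure := by
  have := hh.isLocallyFiniteMeasure
  set K := c '' tsupport χ with hKdef
  have hK : IsCompact K := (isClosed_tsupport χ).isCompact.image_of_continuousOn
    (c.continuousOn.mono hsupp)
  have hKU : K ⊆ c.target := by
    rintro _ ⟨x, hx, rfl⟩
    exact c.map_source (hsupp hx)
  have hsymm : ∀ y ∈ c.target, y ∉ K → c.symm y ∉ tsupport χ := fun y hy hyK hmem =>
    hyK ⟨c.symm y, hmem, c.right_inv hy⟩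
  -- Outside `c.target` the inverse chart has arbitrary values, so the pulled-back cutoff is
  -- extended by zero.
  set ψ : Coord n → ℝ := c.target.indicator fun y => χ (c.symm y) with hψdef
  have hψ : ContDiffOn ℝ ∞ ψ c.target :=
    (hχ c hc).congr fun y hy => indicator_of_mem hy _
  have hψ0 : ∀ y ∉ K, ψ y = 0 := fun y hy => by
    by_cases hyt : y ∈ c.target
    · rw [hψdef, indicator_of_mem hyt]
      exact image_eq_zero_of_notMem_tsupport (hsymm y hyt hy)
    · exact indicator_of_notMem hyt _
  have hψpd : ∀ y ∈ c.target, ∀ i, pderiv i ψ y = pderiv i (fun z => χ (c.symm z)) y := by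
    intro y hy i
    simp only [pderiv]
    rw [Filter.EventuallyEq.fderiv_eq]
    filter_upwards [c.open_target.mem_nhds hy] with z hz using indicator_of_mem hz _
  have hpos : ∀ z ∈ c.target, (h.comp c z).PosDef := fun z hz => hh.comp_posDef hc hz
  have hV := contDiffOn_gradDensity c.open_target (hh.smooth c hc) hpos (hf c hc)
  have key := fun i => integral_pderiv_mul_compactSupport c.open_target hK hKU hψ hψ0 (hV i) i
  have eD : ∀ y ∈ c.target, Real.sqrt (h.comp c y).det * (χ (c.symm y) * D (c.symm y)) =
      ∑ i, ψ y * pderiv i (gradDensity (h.comp c) (fun z => f (c.symm z)) i) y := by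
    intro y hy
    rw [hD y hy, ← Finset.mul_sum, sum_pderiv_gradDensity c.open_target (hh.smooth c hc) hpos
      (hf c hc) hy, hψdef, indicator_of_mem hy]
    ring
  have eQ : ∀ y ∈ c.target, Real.sqrt (h.comp c y).det * gradInner h χ f (c.symm y) =
      ∑ i, pderiv i ψ y * gradDensity (h.comp c) (fun z => f (c.symm z)) i y := by
    intro y hy
    rw [gradInner_eq hχ hf hc hy, Finset.mul_sum]
    refine Finset.sum_congr rfl fun i _ => ?_
    rw [hψpd y hy, gradDensity]
    ring
  have sD : ∀ y ∉ c.target,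
      ∑ i, ψ y * pderiv i (gradDensity (h.comp c) (fun z => f (c.symm z)) i) y = 0 := by
    intro y hy
    simp [hψ0 y fun hk => hy (hKU hk)]
  have sQ : ∀ y ∉ c.target,
      ∑ i, pderiv i ψ y * gradDensity (h.comp c) (fun z => f (c.symm z)) i y = 0 := by
    intro y hy
    have : ψ =ᶠ[𝓝 y] fun _ => 0 := by
      filter_upwards [hK.isClosed.isOpen_compl.mem_nhds fun hk => hy (hKU hk)] with z hz
        using hψ0 z hz
    simp [pderiv, this.fderiv_eq]
  have contQ : ContinuousOn (gradInner h χ f) c.source := by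
    have h1 : ContinuousOn (fun y => gradInner h χ f (c.symm y)) c.target := by
      refine ContinuousOn.congr (f := fun y => ∑ i, pderiv i (fun z => χ (c.symm z)) y *
        ∑ j, (h.comp c y)⁻¹ i j * pderiv j (fun z => f (c.symm z)) y) ?_
        fun y hy => gradInner_eq hχ hf hc hy
      refine continuousOn_finsetSum _ fun i _ =>
        (contDiffOn_pderiv c.open_target (hχ c hc) i).continuousOn.mul ?_
      refine continuousOn_finsetSum _ fun j _ => ?_
      exact (Matrix.contDiffOn_inv_apply (hh.smooth c hc)
        (fun z hz => (hpos z hz).det_pos.ne') i j).continuousOn.mul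
        (contDiffOn_pderiv c.open_target (hf c hc) j).continuousOn
    refine (h1.comp c.continuousOn fun x hx => c.map_source hx).congr fun x hx => ?_
    simp [c.left_inv hx]
  have mQ : AEStronglyMeasurable (gradInner h χ f) (h.volumeMeasure.restrict c.source) :=
    contQ.aestronglyMeasurable c.open_source.measurableSet
  have mD : AEStronglyMeasurable (fun x => χ x * D x) (h.volumeMeasure.restrict c.source) :=
    (hχcont.mul hDcont).aestronglyMeasurable
  have zQ : ∀ x ∉ c.source, gradInner h χ f x = 0 := fun x hx =>
    gradInner_eq_zero_of_notMem_tsupport fun hs => hx (hsupp hs)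
  have zD : ∀ x ∉ c.source, χ x * D x = 0 := fun x hx => by
    rw [image_eq_zero_of_notMem_tsupport fun hs => hx (hsupp hs), zero_mul]
  have mt := c.open_target.measurableSet
  constructor
  · refine (integrableOn_iff_integrable_of_support_subset (s := c.source) ?_).1 ?_
    · intro x hx
      by_contra hn
      exact hx (zQ x hn)
    · rw [integrableOn_source_iff hh hc mQ, integrableOn_congr_fun eQ mt]
      exact (integrable_finsetSum _ fun i _ => (key i).2.1).integrableOn
  · rw [← setIntegral_eq_integral_of_forall_compl_eq_zero zD,
      ← setIntegral_eq_integral_of_forall_compl_eq_zero zQ, setIntegral_source_eq hh hc mD,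
      setIntegral_source_eq hh hc mQ, setIntegral_congr_fun mt eD, setIntegral_congr_fun mt eQ,
      setIntegral_eq_integral_of_forall_compl_eq_zero sD,
      setIntegral_eq_integral_of_forall_compl_eq_zero sQ,
      integral_finsetSum _ fun i _ => (key i).1, integral_finsetSum _ fun i _ => (key i).2.1,
      ← Finset.sum_neg_distrib]
    exact Finset.sum_congr rfl fun i _ => (key i).2.2

/-- The integral of a Laplacian over a closed Riemannian manifold vanishes. -/
theorem integral_laplacian_eq_zero (hh : h.IsRiemannian) (hf : SmoothInCharts n f)
    (hDcont : Continuous D)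
    (hD : ∀ c ∈ atlas (Coord n) X, ∀ y ∈ c.target,
      D (c.symm y) = laplacian (h.comp c) (fun z => f (c.symm z)) y) :
    ∫ x, D x ∂h.volumeMeasure = 0 := by
  have := hh.isLocallyFiniteMeasure
  obtain ⟨s, hs⟩ := CompactSpace.elim_nhds_subcover
    (fun x : X => (chartAt (Coord n) x).source) fun x => chart_source_mem_nhds _ x
  obtain ⟨ρ, hρ⟩ := SmoothPartitionOfUnity.exists_isSubordinate (𝓡 n) (isClosed_univ (X := X))
    (fun x : s => (chartAt (Coord n) (x : X)).source) (fun x => (chartAt (Coord n) (x : X)).open_source)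
    (by
      intro x _
      have : x ∈ ⋃ z ∈ s, (chartAt (Coord n) z).source := by rw [hs]; trivial
      simpa using this)
  have hsum : ∀ x, ∑ a, ρ a x = 1 := fun x => by
    rw [← finsum_eq_sum_of_fintype]
    exact ρ.sum_eq_one (mem_univ x)
  have hsm : ∀ a, SmoothInCharts n (ρ a) := fun a => (ρ a).contMDiff.smoothInCharts
  have hct : ∀ a, Continuous (ρ a) := fun a => (ρ a).contMDiff.continuous
  have key := fun a => integral_div_chart hh hf (hsm a) (hct a)
    (chart_mem_atlas (Coord n) (a : X)) (hρ a) hDcont (hD _ (chart_mem_atlas _ _))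
  -- The partition of unity sums to the constant one, so its differentials sum to zero. The error
  -- terms of the local divergence theorems therefore cancel, and no cutoff estimate is needed.
  have hgrad : ∀ x, ∑ a, gradInner h (ρ a) f x = 0 := by
    intro x
    have h1 : ∑ a, (differential (ρ a) x : Fin n → ℝ) = 0 := by
      set c := chartAt (Coord n) x
      have hc : c ∈ atlas (Coord n) X := chart_mem_atlas _ _
      have hy : c x ∈ c.target := mem_chart_target _ x
      have hx : c.symm (c x) = x := c.left_inv (mem_chart_source _ x)
      have hJ : IsUnit (coordMatrix c (c x)).transpose := by
        rw [Matrix.isUnit_iff_isUnit_det, Matrix.det_transpose]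
        exact isUnit_iff_ne_zero.2 (coordMatrix_det_ne_zero hc hy)
      refine Matrix.mulVec_injective_of_isUnit hJ ?_
      rw [Matrix.mulVec_zero, Matrix.mulVec_sum]
      have h2 : ∀ a, (coordMatrix c (c x)).transpose.mulVec (differential (ρ a) x) =
          fun i => pderiv i (fun z => ρ a (c.symm z)) (c x) := fun a => by
        rw [(hsm a).pderiv_eq hc hy, hx]
      simp only [h2]
      ext i
      rw [Finset.sum_apply]
      simp only [pderiv]
      rw [← sum_apply, ← fderiv_fun_sum fun a _ =>
        differentiableAt_of_contDiffOn c.open_target (hsm a c hc) hy]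
      simp only [hsum, fderiv_fun_const]
      rfl
    simp only [gradInner, ← sum_dotProduct, h1, zero_dotProduct]
  have hint : ∀ a, Integrable (fun x => ρ a x * D x) h.volumeMeasure := fun a =>
    ((hct a).mul hDcont).integrable_of_hasCompactSupport (HasCompactSupport.of_compactSpace _)
  calc ∫ x, D x ∂h.volumeMeasure = ∫ x, ∑ a, ρ a x * D x ∂h.volumeMeasure := by
        refine integral_congr_ae (Eventually.of_forall fun x => ?_)
        simp only [← Finset.sum_mul, hsum, one_mul]
    _ = ∑ a, ∫ x, ρ a x * D x ∂h.volumeMeasure := integral_finsetSum _ fun a _ => hint a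
    _ = - ∑ a, ∫ x, gradInner h (ρ a) f x ∂h.volumeMeasure := by
        rw [← Finset.sum_neg_distrib]
        exact Finset.sum_congr rfl fun a _ => (key a).2
    _ = - ∫ x, ∑ a, gradInner h (ρ a) f x ∂h.volumeMeasure := by
        rw [integral_finsetSum _ fun a _ => (key a).1]
    _ = 0 := by simp only [hgrad, integral_zero, neg_zero]

end Divergence

/-! ### Rescaling -/

section Rescaling

open CoordTensor

variable {n : ℕ}

theorem Matrix.inv_smul_of_ne_zero {a : ℝ} (ha : a ≠ 0) (A : Matrix (Fin n) (Fin n) ℝ) :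
    (a • A)⁻¹ = a⁻¹ • A⁻¹ := by
  by_cases hA : IsUnit A.det
  · exact Matrix.inv_eq_left_inv (by
      rw [Matrix.smul_mul, Matrix.mul_smul, smul_smul, inv_mul_cancel₀ ha, one_smul,
        Matrix.nonsing_inv_mul _ hA])
  · rw [Matrix.nonsing_inv_apply_not_isUnit _ hA, Matrix.nonsing_inv_apply_not_isUnit, smul_zero]
    rw [Matrix.det_smul]
    rw [isUnit_iff_ne_zero, not_not] at hA ⊢
    rw [hA, mul_zero]

theorem CoordTensor.pderiv_const_mul (a : ℝ) (f : Coord n → ℝ) (k : Fin n) (y : Coord n) :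
    pderiv k (fun z => a * f z) y = a * pderiv k f y := by
  have : (fun z => a * f z) = a • f := rfl
  rw [pderiv, this, fderiv_const_smul_field]
  rfl

variable {a b : ℝ} (G T : CoordTensor n) (y : Coord n)

/-- The constant factor in the derivatives of the metric cancels against the one in its inverse.
Hence the Ricci tensor is unchanged too, and the scalar curvature scales only through its
contraction. -/
theorem CoordTensor.christoffel_smul (ha : a ≠ 0) (k i j : Fin n) :
    christoffel (fun z => a • G z) k i j = christoffel G k i j := by
  ext y
  simp only [christoffel, Matrix.inv_smul_of_ne_zero ha, Matrix.smul_apply, smul_eq_mul,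
    pderiv_const_mul]
  congr 1
  refine Finset.sum_congr rfl fun l _ => ?_
  field_simp

theorem CoordTensor.scalar_smul (ha : a ≠ 0) :
    scalar (fun z => a • G z) y = a⁻¹ * scalar G y := by
  simp only [scalar, ricci, christoffel_smul G ha, Matrix.inv_smul_of_ne_zero ha,
    Matrix.smul_apply, smul_eq_mul, Finset.mul_sum, mul_assoc]

/-- The trace-free part scales by `b`, and each of the two inverse metrics in the norm by `a⁻¹`. For
the rescaled flow `a = s⁻²` and `b = s⁻¹`, so the factor is `s²`. -/
theorem CoordTensor.normSq_traceFree_smul (ha : a ≠ 0) :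
    normSq (fun z => a • G z) (traceFree (fun z => a • G z) (fun z => b • T z)) y =
      (b / a) ^ 2 * normSq G (traceFree G T) y := by
  have ht : CoordTensor.trace (fun z => a • G z) (fun z => b • T z) y =
      b / a * CoordTensor.trace G T y := by
    simp only [CoordTensor.trace, Matrix.inv_smul_of_ne_zero ha, Matrix.smul_apply, smul_eq_mul,
      Finset.mul_sum]
    refine Finset.sum_congr rfl fun i _ => Finset.sum_congr rfl fun j _ => ?_
    field_simp
  have hT : ∀ i j, traceFree (fun z => a • G z) (fun z => b • T z) y i j =
      b * traceFree G T y i j := by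
    intro i j
    simp only [traceFree, ht, Matrix.sub_apply, Matrix.smul_apply, smul_eq_mul]
    field_simp
  simp only [normSq, hT, Matrix.inv_smul_of_ne_zero ha, Matrix.smul_apply, smul_eq_mul,
    Finset.mul_sum]
  refine Finset.sum_congr rfl fun i _ => Finset.sum_congr rfl fun j _ =>
    Finset.sum_congr rfl fun k _ => Finset.sum_congr rfl fun l _ => ?_
  field_simp

variable {X : Type*} [TopologicalSpace X] [ChartedSpace (Coord n) X]

theorem TwoTensor.comp_smul (T : TwoTensor n X) (c : OpenPartialHomeomorph X (Coord n)) (a : ℝ) :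
    TwoTensor.comp (fun x => a • T x) c = fun y => a • T.comp c y := by
  ext y i j
  rfl

theorem FlowData.rescale_K0sq (F : FlowData n X) {s : ℝ} (hs : s ≠ 0) (u : ℝ) (x : X) :
    (F.rescale s).K0sq u x = s ^ 2 * F.K0sq (s * u) x := by
  simp only [FlowData.K0sq, FlowData.rescale, TwoTensor.traceFreeNormSq, TwoTensor.comp_smul]
  rw [normSq_traceFree_smul _ _ _ (inv_ne_zero (pow_ne_zero 2 hs))]
  congr 1
  field_simp

theorem FlowData.rescale_R (F : FlowData n X) {s : ℝ} (hs : s ≠ 0) (u : ℝ) (x : X) :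
    (F.rescale s).R u x = s ^ 2 * F.R (s * u) x := by
  simp only [FlowData.R, FlowData.rescale, TwoTensor.scalarCurvature, TwoTensor.comp_smul]
  rw [scalar_smul _ _ (inv_ne_zero (pow_ne_zero 2 hs)), inv_inv]

end Rescaling

/-! ### Consequences of the flow equations -/

namespace FlowData

open CoordTensor

variable {n : ℕ} {X : Type*} [TopologicalSpace X] [ChartedSpace (Coord n) X]
  {I : Set ℝ} {F : FlowData n X}

theorem IsEinsteinFlow.isRiemannian (hF : F.IsEinsteinFlow I) {t : ℝ} (ht : t ∈ I) :
    (F.h t).IsRiemannian where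
  symm := hF.metric_symm t ht
  pos := hF.metric_pos t ht
  smooth c hc i j := (hF.smooth_h c hc i j).comp
    (contDiff_const.prodMk contDiff_id).contDiffOn fun _ hy => ⟨ht, hy⟩

theorem IsEinsteinFlow.smoothInCharts_L (hF : F.IsEinsteinFlow I) {t : ℝ} (ht : t ∈ I) :
    SmoothInCharts n (F.L t) := fun c hc =>
  (hF.smooth_L c hc).comp (contDiff_const.prodMk contDiff_id).contDiffOn fun _ hy => ⟨ht, hy⟩

theorem IsExpandingCMC.uniqueDiffOn (hF : F.IsExpandingCMC I) : UniqueDiffOn ℝ I := by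
  obtain ⟨t₀, rfl | rfl⟩ := hF.future
  · exact uniqueDiffOn_Ici t₀
  · exact uniqueDiffOn_Ioi t₀

theorem IsExpandingCMC.eventually_mem (hF : F.IsExpandingCMC I) : ∀ᶠ t in atTop, t ∈ I := by
  obtain ⟨t₀, rfl | rfl⟩ := hF.future
  · exact eventually_ge_atTop t₀
  · exact eventually_gt_atTop t₀

theorem IsExpandingCMC.H_neg (hF : F.IsExpandingCMC I) {t : ℝ} (ht : t ∈ I) (x : X) :
    F.H t x < 0 := by
  obtain ⟨η, h1, -, h2, -⟩ := hF.cmc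
  rw [h1 t ht x]
  exact h2 t ht

/-- In dimension zero the Hubble time relation would read `t = 0`, whereas the time interval is
unbounded above. -/
theorem IsExpandingCMC.dim_pos [Nonempty X] (hF : F.IsExpandingCMC I) (hH : F.IsHubbleTime I) :
    0 < n := by
  rcases Nat.eq_zero_or_pos n with rfl | h
  · exfalso
    obtain ⟨x⟩ := ‹Nonempty X›
    obtain ⟨t, ht, h1⟩ := (hF.eventually_mem.and (eventually_gt_atTop 0)).exists
    have := hH t ht x
    simp at this
    linarith
  · exact h

theorem IsExpandingCMC.time_pos [Nonempty X] (hF : F.IsExpandingCMC I) (hH : F.IsHubbleTime I)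
    {t : ℝ} (ht : t ∈ I) : 0 < t := by
  have hn := hF.dim_pos hH
  obtain ⟨x⟩ := ‹Nonempty X›
  rw [hH t ht x]
  have : (0 : ℝ) < n := by exact_mod_cast hn
  exact div_pos_of_neg_of_neg (by linarith) (hF.H_neg ht x)

theorem IsExpandingCMC.H_eq [Nonempty X] (hF : F.IsExpandingCMC I) (hH : F.IsHubbleTime I)
    {t : ℝ} (ht : t ∈ I) (x : X) : F.H t x = -n / t := by
  have h1 := hH t ht x
  have h2 := (hF.H_neg ht x).ne
  have h3 := (hF.time_pos hH ht).ne'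
  field_simp at h1 ⊢
  linarith

variable [IsManifold (𝓡 n) ∞ X] {c : OpenPartialHomeomorph X (Coord n)} {y : Coord n} {t : ℝ}

theorem IsExpandingCMC.trace_eq [Nonempty X] (hF : F.IsExpandingCMC I) (hH : F.IsHubbleTime I)
    (ht : t ∈ I) (hc : c ∈ atlas (Coord n) X) (hy : y ∈ c.target) :
    CoordTensor.trace ((F.h t).comp c) ((F.K t).comp c) y = -n / t := by
  rw [trace_comp_eq_trace hc hy]
  exact hF.H_eq hH ht _

omit [IsManifold (𝓡 n) ∞ X] in
theorem IsEinsteinFlow.K_comp_symm (hF : F.IsEinsteinFlow I) (ht : t ∈ I) (i j : Fin n) :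
    (F.K t).comp c y i j = (F.K t).comp c y j i :=
  hF.K_symm t ht _ _ _

/-- Both sides are the full contraction of `B` with itself. In the derivative of the trace, one
comes from varying `h^ij` and the other from the quadratic term in the evolution of `K`; this
identity makes them cancel. -/
theorem sum_inv_mul_sq {m : Type*} [Fintype m] {P B : Matrix m m ℝ} (hP : ∀ i j, P i j = P j i)
    (hB : ∀ i j, B i j = B j i) :
    ∑ i, ∑ j, (P * B * P) i j * B i j = ∑ i, ∑ j, P i j * ∑ k, ∑ l, P k l * B i k * B l j := by
  simp only [Matrix.mul_apply, Finset.sum_mul, Finset.mul_sum]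
  refine Finset.sum_congr rfl fun i _ => ?_
  calc _ = ∑ j, ∑ a, ∑ b, P i a * B a b * P b j * B i j :=
        Finset.sum_congr rfl fun j _ => Finset.sum_comm
    _ = ∑ a, ∑ j, ∑ b, P i a * B a b * P b j * B i j := Finset.sum_comm
    _ = _ := by
        refine Finset.sum_congr rfl fun a _ => Finset.sum_congr rfl fun j _ =>
          Finset.sum_congr rfl fun b _ => ?_
        rw [hB a b, hP b j]
        ring

/-- The elliptic equation satisfied by the lapse function in Hubble time. -/
theorem IsExpandingCMC.lapse_equation [Nonempty X] (hF : F.IsExpandingCMC I)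
    (hH : F.IsHubbleTime I) (ht : t ∈ I) (hc : c ∈ atlas (Coord n) X) (hy : y ∈ c.target) :
    laplacian ((F.h t).comp c) (fun z => F.L t (c.symm z)) y =
      F.K0sq t (c.symm y) * F.L t (c.symm y) - n / t ^ 2 * (1 - F.L t (c.symm y)) := by
  have hR := hF.isRiemannian ht
  have hpd := hR.comp_posDef hc hy
  have htpos := hF.time_pos hH ht
  have hn : (0 : ℝ) < n := by exact_mod_cast hF.dim_pos hH
  set P := ((F.h t).comp c y)⁻¹ with hPdef
  set B := (F.K t).comp c y with hBdef
  set ℓ := F.L t (c.symm y) with hℓ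
  have hPs : ∀ i j, P i j = P j i := fun i j => by
    simpa using hpd.inv.isHermitian.apply j i
  have hBs : ∀ i j, B i j = B j i := fun i j => hF.K_comp_symm ht i j
  have hA := hF.evolution_h t ht c hc y hy
  have hK := hF.evolution_K t ht c hc y hy
  have hinv := Matrix.hasDerivWithinAt_inv (A' := (-2 * ℓ) • B)
    (A := fun τ => (F.h τ).comp c y) (fun i j => hA i j) hpd.det_pos.ne'
  have hd := HasDerivWithinAt.fun_sum (u := Finset.univ) fun i _ =>
    HasDerivWithinAt.fun_sum (u := Finset.univ) fun j _ => (hinv i j).fun_mul (hK i j)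
  -- The derivative of the trace is computed twice: from its explicit value in Hubble time and from
  -- the evolution equations. Unique differentiability of `I` makes them agree even at an endpoint.
  have hconst : HasDerivWithinAt (fun τ => -(n : ℝ) / τ) (n / t ^ 2) I t := by
    have := ((hasDerivAt_inv htpos.ne').const_mul (-(n : ℝ))).hasDerivWithinAt (s := I)
    simpa [div_eq_mul_inv] using this
  have hd' := hd.congr (f₁ := fun τ => -(n : ℝ) / τ)
    (fun τ hτ => (hF.trace_eq hH hτ hc hy).symm) (hF.trace_eq hH ht hc hy).symm
  have heq := (hF.uniqueDiffOn t ht).eq_deriv _ hconst hd'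
  have htr := hF.trace_eq hH ht hc hy
  have hham := hF.hamiltonian t ht c hc y hy
  rw [normSq_traceFree_comp_eq_traceFreeNormSq hc hy, htr] at hham
  simp only [htr, ← hPdef, ← hBdef, ← hℓ] at heq
  have hsq := sum_inv_mul_sq hPs hBs
  have htr' : ∑ i, ∑ j, P i j * B i j = -n / t := htr
  have hexp : ∑ i, ∑ j, ((-(P * (-2 * ℓ) • B * P)) i j * B i j +
      P i j * (ℓ * (-n / t) * B i j - 2 * ℓ * ∑ k, ∑ l, P k l * B i k * B l j
        - hessian ((F.h t).comp c) (fun z => F.L t (c.symm z)) i j y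
        + ℓ * ricci ((F.h t).comp c) i j y)) =
      2 * ℓ * (∑ i, ∑ j, (P * B * P) i j * B i j) + ℓ * (-n / t) * (∑ i, ∑ j, P i j * B i j)
        - 2 * ℓ * (∑ i, ∑ j, P i j * ∑ k, ∑ l, P k l * B i k * B l j)
        - laplacian ((F.h t).comp c) (fun z => F.L t (c.symm z)) y
        + ℓ * scalar ((F.h t).comp c) y := by
    simp only [laplacian, scalar, Finset.mul_sum, ← Finset.sum_add_distrib,
      ← Finset.sum_sub_distrib, ← hPdef]
    refine Finset.sum_congr rfl fun i _ => Finset.sum_congr rfl fun j _ => ?_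
    simp only [Matrix.neg_apply, Matrix.mul_smul, Matrix.smul_mul, Matrix.smul_apply, smul_eq_mul,
      mul_add, mul_sub, ← Finset.mul_sum]
    ring
  rw [hexp, hsq, htr'] at heq
  have hK0 : F.K0sq t (c.symm y) = (F.h t).traceFreeNormSq (F.K t) (c.symm y) := rfl
  rw [hK0]
  have hs : scalar ((F.h t).comp c) y = (F.h t).traceFreeNormSq (F.K t) (c.symm y) -
    (1 - 1 / (n : ℝ)) * (-n / t) ^ 2 := by linarith
  rw [hs] at heq
  -- The term `H²` cancels the one coming from `L H K` in the evolution of `K`, leaving `H²/n =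
  -- n/t²` as the coefficient of `L`.
  have e : (1 - 1 / (n : ℝ)) * (-n / t) ^ 2 = (-n / t) ^ 2 - n / t ^ 2 := by
    field_simp
  rw [e] at heq
  have e2 : (-(n : ℝ) / t) ^ 2 = -n / t * (-n / t) := sq _
  rw [e2] at heq
  linear_combination heq

theorem IsEinsteinFlow.K0sq_nonneg (hF : F.IsEinsteinFlow I) (ht : t ∈ I) (x : X) :
    0 ≤ F.K0sq t x :=
  TwoTensor.traceFreeNormSq_nonneg (hF.metric_symm t ht x) (hF.metric_pos t ht x)

omit [IsManifold (𝓡 n) ∞ X] in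
theorem continuousOn_of_charts {φ : ℝ → X → ℝ}
    (hφ : ∀ c ∈ atlas (Coord n) X,
      ContinuousOn (fun p : ℝ × Coord n => φ p.1 (c.symm p.2)) (I ×ˢ c.target)) :
    ContinuousOn (fun p : ℝ × X => φ p.1 p.2) (I ×ˢ univ) := by
  rintro ⟨t, x⟩ ⟨ht, -⟩
  set c := chartAt (Coord n) x
  have hx : x ∈ c.source := mem_chart_source _ x
  have h1 : ContinuousOn (fun p : ℝ × X => φ p.1 p.2) (I ×ˢ c.source) := by
    refine ((hφ c (chart_mem_atlas _ _)).comp (f := fun p : ℝ × X => (p.1, c p.2)) ?_ ?_).congr ?_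
    · exact continuousOn_fst.prodMk (c.continuousOn.comp continuousOn_snd fun p hp => hp.2)
    · exact fun p hp => ⟨hp.1, c.map_source hp.2⟩
    · intro p hp
      simp [c.left_inv hp.2]
  refine (h1 (t, x) ⟨ht, hx⟩).mono_of_mem_nhdsWithin ?_
  rw [mem_nhdsWithin]
  exact ⟨univ ×ˢ c.source, isOpen_univ.prod c.open_source, ⟨trivial, hx⟩,
    fun p hp => ⟨hp.2.1, hp.1.2⟩⟩

omit [IsManifold (𝓡 n) ∞ X] in
theorem IsEinsteinFlow.continuousOn_L (hF : F.IsEinsteinFlow I) :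
    ContinuousOn (fun p : ℝ × X => F.L p.1 p.2) (I ×ˢ univ) :=
  continuousOn_of_charts (n := n) fun c hc => (hF.smooth_L c hc).continuousOn

theorem IsEinsteinFlow.continuousOn_K0sq (hF : F.IsEinsteinFlow I) :
    ContinuousOn (fun p : ℝ × X => F.K0sq p.1 p.2) (I ×ˢ univ) := by
  refine continuousOn_of_charts (n := n) fun c hc => ?_
  refine ContinuousOn.congr (f := fun p : ℝ × Coord n => normSq ((F.h p.1).comp c)
    (traceFree ((F.h p.1).comp c) ((F.K p.1).comp c)) p.2) ?_
    fun p hp => (normSq_traceFree_comp_eq_traceFreeNormSq hc hp.2).symm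
  have hG := fun i j => (hF.smooth_h c hc i j).continuousOn
  have hK := fun i j => (hF.smooth_K c hc i j).continuousOn
  have hP := fun i j => (Matrix.contDiffOn_inv_apply (A := fun p : ℝ × Coord n =>
    (F.h p.1).comp c p.2) (hF.smooth_h c hc)
    (fun p hp => ((hF.isRiemannian hp.1).det_pos hc hp.2).ne') i j).continuousOn
  have htr : ContinuousOn (fun p : ℝ × Coord n =>
      CoordTensor.trace ((F.h p.1).comp c) ((F.K p.1).comp c) p.2) (I ×ˢ c.target) :=
    continuousOn_finsetSum _ fun i _ => continuousOn_finsetSum _ fun j _ => (hP i j).mul (hK i j)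
  have hT : ∀ i j, ContinuousOn (fun p : ℝ × Coord n =>
      traceFree ((F.h p.1).comp c) ((F.K p.1).comp c) p.2 i j) (I ×ˢ c.target) := fun i j =>
    (hK i j).sub ((htr.div_const _).mul (hG i j))
  exact continuousOn_finsetSum _ fun i _ => continuousOn_finsetSum _ fun j _ =>
    continuousOn_finsetSum _ fun k _ => continuousOn_finsetSum _ fun l _ =>
    (((hP i k).mul (hP j l)).mul (hT i j)).mul (hT k l)

omit [IsManifold (𝓡 n) ∞ X] in
theorem continuous_slice {φ : ℝ → X → ℝ}
    (hφ : ContinuousOn (fun p : ℝ × X => φ p.1 p.2) (I ×ˢ univ)) (ht : t ∈ I) :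
    Continuous (φ t) :=
  continuousOn_univ.1 (hφ.comp (f := fun x : X => (t, x)) (by fun_prop) fun _ _ => ⟨ht, trivial⟩)

/-- The maximum principle: the lapse function of Hubble time is at most one. -/
theorem IsExpandingCMC.lapse_le_one [Nonempty X] [CompactSpace X] (hF : F.IsExpandingCMC I)
    (hH : F.IsHubbleTime I) (ht : t ∈ I) (x : X) : F.L t x ≤ 1 := by
  have hcont : Continuous (F.L t) := continuous_slice hF.continuousOn_L ht
  obtain ⟨z, -, hz⟩ := isCompact_univ.exists_isMaxOn univ_nonempty hcont.continuousOn
  refine (hz (mem_univ x)).trans ?_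
  set c := chartAt (Coord n) z
  have hc : c ∈ atlas (Coord n) X := chart_mem_atlas _ _
  have hy : c z ∈ c.target := mem_chart_target _ z
  have hzz : c.symm (c z) = z := c.left_inv (mem_chart_source _ z)
  have hle := laplacian_nonpos_of_isLocalMax c.open_target
    ((hF.isRiemannian ht).comp_posDef hc hy) (hF.smoothInCharts_L ht c hc) hy
    (Eventually.of_forall fun y => by
      simp only [hzz]
      exact hz (mem_univ _))
  rw [hF.lapse_equation hH ht hc hy, hzz] at hle
  have h1 := mul_nonneg (hF.K0sq_nonneg ht z) (hF.lapse_nonneg t ht z)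
  have hn : (0 : ℝ) < n := by exact_mod_cast hF.dim_pos hH
  have h2 : 0 < (n : ℝ) / t ^ 2 := div_pos hn (pow_pos (hF.time_pos hH ht) 2)
  -- If `L > 1` at its maximum, the right side of the lapse equation is at least `(n/t²)(L - 1) >
  -- 0`, contrary to the sign of the Laplacian.
  by_contra hlt
  push Not at hlt
  nlinarith [mul_pos h2 (sub_pos.2 hlt)]

/-- The integrated lapse equation. -/
theorem IsExpandingCMC.integral_K0sq_mul_L [Nonempty X] [CompactSpace X] [T2Space X]
    [MeasurableSpace X] [BorelSpace X] (hF : F.IsExpandingCMC I)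
    (hH : F.IsHubbleTime I) (ht : t ∈ I) :
    ∫ x, F.K0sq t x * F.L t x ∂(F.h t).volumeMeasure =
      n / t ^ 2 * ∫ x, (1 - F.L t x) ∂(F.h t).volumeMeasure := by
  have hR := hF.isRiemannian ht
  have := hR.isLocallyFiniteMeasure
  have hL : Continuous (F.L t) := continuous_slice hF.continuousOn_L ht
  have hK : Continuous (F.K0sq t) := continuous_slice hF.continuousOn_K0sq ht
  have h0 := integral_laplacian_eq_zero (D := fun x => F.K0sq t x * F.L t x -
    n / t ^ 2 * (1 - F.L t x)) hR (hF.smoothInCharts_L ht) (by fun_prop)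
    fun c hc y hy => (hF.lapse_equation hH ht hc hy).symm
  have hint : ∀ φ : X → ℝ, Continuous φ → Integrable φ (F.h t).volumeMeasure := fun φ hφ =>
    hφ.integrable_of_hasCompactSupport (HasCompactSupport.of_compactSpace _)
  rw [integral_sub (hint (fun x => F.K0sq t x * F.L t x) (hK.mul hL))
    (hint (fun x => n / t ^ 2 * (1 - F.L t x)) (by fun_prop)), integral_const_mul] at h0
  linarith

/-- The density of `t⁻ⁿ dvol(h(t))` with respect to `dvol(h(t₁))`. -/
def density (F : FlowData n X) (t₁ t : ℝ) (x : X) : ℝ :=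
  (t ^ n)⁻¹ * Real.sqrt (((F.h t).mat x).det / ((F.h t₁).mat x).det)

theorem density_chart_eq (t₁ t : ℝ) (hc : c ∈ atlas (Coord n) X) (hy : y ∈ c.target) :
    F.density t₁ t (c.symm y) =
      (t ^ n)⁻¹ * Real.sqrt (((F.h t).comp c y).det / ((F.h t₁).comp c y).det) := by
  have hJ := coordMatrix_det_ne_zero hc hy
  rw [density, TwoTensor.comp_eq, TwoTensor.comp_eq]
  simp only [Matrix.det_mul, Matrix.det_transpose]
  congr 2
  rw [mul_right_comm, mul_right_comm (coordMatrix c y).det ((F.h t₁).mat _).det,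
    mul_div_mul_left _ _ (mul_ne_zero hJ hJ)]

theorem IsExpandingCMC.continuousOn_density [Nonempty X] (hF : F.IsExpandingCMC I)
    (hH : F.IsHubbleTime I) {t₁ : ℝ} (ht₁ : t₁ ∈ I) :
    ContinuousOn (fun p : ℝ × X => F.density t₁ p.1 p.2) (I ×ˢ univ) := by
  refine continuousOn_of_charts (n := n) fun c hc => ?_
  refine ContinuousOn.congr (f := fun p : ℝ × Coord n => (p.1 ^ n)⁻¹ * Real.sqrt
    (((F.h p.1).comp c p.2).det / ((F.h t₁).comp c p.2).det)) ?_
    fun p hp => density_chart_eq t₁ p.1 hc hp.2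
  have h1 := (Matrix.contDiffOn_det (A := fun p : ℝ × Coord n => (F.h p.1).comp c p.2)
    (hF.smooth_h c hc)).continuousOn
  have h2 : ContinuousOn (fun p : ℝ × Coord n => ((F.h t₁).comp c p.2).det) (I ×ˢ c.target) :=
    (Matrix.contDiffOn_det ((hF.isRiemannian ht₁).smooth c hc)).continuousOn.comp
      continuousOn_snd fun p hp => hp.2
  refine ContinuousOn.mul ?_ (Real.continuous_sqrt.comp_continuousOn (h1.div h2 fun p hp =>
    ((hF.isRiemannian ht₁).det_pos hc hp.2).ne'))
  exact (continuousOn_fst.pow n).inv₀ fun p hp => (pow_pos (hF.time_pos hH hp.1) n).ne'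

omit [IsManifold (𝓡 n) ∞ X] in
theorem IsExpandingCMC.density_pos [Nonempty X] (hF : F.IsExpandingCMC I)
    (hH : F.IsHubbleTime I) {t₁ : ℝ} (ht₁ : t₁ ∈ I) (ht : t ∈ I) (x : X) :
    0 < F.density t₁ t x :=
  mul_pos (inv_pos.2 (pow_pos (hF.time_pos hH ht) n)) (Real.sqrt_pos.2
    (div_pos ((hF.isRiemannian ht).mat_posDef x).det_pos
      ((hF.isRiemannian ht₁).mat_posDef x).det_pos))

/-- The evolution of the normalized volume density. -/
theorem IsExpandingCMC.hasDerivWithinAt_density [Nonempty X] (hF : F.IsExpandingCMC I)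
    (hH : F.IsHubbleTime I) {t₁ : ℝ} (ht₁ : t₁ ∈ I) (ht : t ∈ I) (x : X) :
    HasDerivWithinAt (fun τ => F.density t₁ τ x)
      (F.density t₁ t x * (n / t * (F.L t x - 1))) I t := by
  set c := chartAt (Coord n) x
  have hc : c ∈ atlas (Coord n) X := chart_mem_atlas _ _
  have hy : c x ∈ c.target := mem_chart_target _ x
  have hx : c.symm (c x) = x := c.left_inv (mem_chart_source _ x)
  have htpos := hF.time_pos hH ht
  have hden : ∀ τ, F.density t₁ τ x =
      (τ ^ n)⁻¹ * Real.sqrt (((F.h τ).comp c (c x)).det / ((F.h t₁).comp c (c x)).det) := by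
    intro τ
    conv_lhs => rw [← hx]
    exact density_chart_eq t₁ τ hc hy
  have hpd := (hF.isRiemannian ht).comp_posDef hc hy
  have hw := hpd.det_pos
  have hw₁ := (hF.isRiemannian ht₁).det_pos hc hy
  have hdet := Matrix.hasDerivWithinAt_det (A := fun τ => (F.h τ).comp c (c x))
    (A' := (-2 * F.L t x) • (F.K t).comp c (c x)) (s := I) (t := t) (fun i j => by
      have := hF.evolution_h t ht c hc (c x) hy i j
      rwa [hx] at this)
  -- This is Jacobi's formula with `∂_t h = -2LK` and `tr K = -n/t`. The square root halves it to
  -- `nL/t`, and the factor `t⁻ⁿ` contributes `-n/t`.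
  have htrace : Matrix.trace (((F.h t).comp c (c x)).adjugate *
      ((-2 * F.L t x) • (F.K t).comp c (c x))) =
      ((F.h t).comp c (c x)).det * (2 * F.L t x * (n / t)) := by
    have h1 := hF.trace_eq hH ht hc hy
    rw [CoordTensor.trace_eq_metricTrace, Matrix.metricTrace] at h1
    have h2 : ((F.K t).comp c (c x)).transpose = (F.K t).comp c (c x) := by
      ext i j
      exact hF.K_comp_symm ht j i
    rw [h2] at h1
    rw [Matrix.adjugate_eq_det_smul_inv hw.ne', Matrix.smul_mul, Matrix.mul_smul,
      Matrix.trace_smul, Matrix.trace_smul, h1]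
    simp only [smul_eq_mul]
    ring
  rw [htrace] at hdet
  have hq := (hdet.div_const ((F.h t₁).comp c (c x)).det).sqrt (div_pos hw hw₁).ne'
  have hp := ((hasDerivAt_pow n t).inv (pow_pos htpos n).ne').hasDerivWithinAt (s := I)
  have hm := hp.fun_mul hq
  refine (hm.congr (fun τ _ => hden τ) (hden t)).congr_deriv ?_
  rw [hden t]
  have hn := hF.dim_pos hH
  set r := Real.sqrt (((F.h t).comp c (c x)).det / ((F.h t₁).comp c (c x)).det) with hr
  have hr0 : 0 < r := Real.sqrt_pos.2 (div_pos hw hw₁)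
  have hr2 : ((F.h t).comp c (c x)).det * (2 * F.L t x * (n / t)) /
      ((F.h t₁).comp c (c x)).det = r * r * (2 * F.L t x * (n / t)) := by
    rw [hr, Real.mul_self_sqrt (div_pos hw hw₁).le]
    ring
  rw [hr2]
  have hpow : (n : ℝ) * t ^ (n - 1) / (t ^ n) ^ 2 = n / t * (t ^ n)⁻¹ := by
    have : t ^ n = t ^ (n - 1) * t := by rw [← pow_succ]; congr 1; omega
    rw [this]
    field_simp
  rw [neg_div, hpow]
  simp only [Pi.inv_apply]
  field_simp
  ring

end FlowData

/-! ### Convergence of monotone families of densities -/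

/-- A norm that tends to zero is eventually finite, so membership in L¹ comes for free once
measurability is known. -/
theorem tendstoZeroL1_of_le {α : Type*} [MeasurableSpace α] {μ : Measure α} {f : ℝ → α → ℝ}
    {B : ℝ → ℝ≥0∞} (hf : ∀ᶠ s in atTop, AEStronglyMeasurable (f s) μ)
    (hle : ∀ᶠ s in atTop, eLpNorm (f s) 1 μ ≤ B s) (hB : Tendsto B atTop (𝓝 0)) :
    TendstoZeroL1 μ f := by
  have h0 : Tendsto (fun s => eLpNorm (f s) 1 μ) atTop (𝓝 0) :=
    tendsto_of_tendsto_of_tendsto_of_le_of_le' tendsto_const_nhds hB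
      (Eventually.of_forall fun _ => zero_le) hle
  refine ⟨?_, h0⟩
  filter_upwards [hf, h0.eventually (gt_mem_nhds zero_lt_one)] with s h1 h2
  exact ⟨h1, h2.trans ENNReal.one_lt_top⟩

/-- Since `ν = (ν - μ) + μ`, the derivative of `ν` minus one is that of the positive measure `ν -
μ`, whose integral is at most the mass of `ν - μ`. A singular part of `ν` only helps the inequality.
-/
theorem eLpNorm_rnDeriv_sub_one_le {α : Type*} [MeasurableSpace α] {μ ν : Measure α}
    [IsFiniteMeasure μ] [IsFiniteMeasure ν] (h : μ ≤ ν) :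
    eLpNorm (fun x => (ν.rnDeriv μ x).toReal - 1) 1 μ ≤ ν univ - μ univ := by
  have h1 : ν.rnDeriv μ =ᵐ[μ] (ν - μ).rnDeriv μ + 1 := by
    have h2 := Measure.rnDeriv_add' (ν - μ) μ μ
    rw [Measure.sub_add_cancel_of_le h] at h2
    filter_upwards [h2, Measure.rnDeriv_self μ] with x hx1 hx2
    rw [hx1, Pi.add_apply, Pi.add_apply, hx2, Pi.one_apply]
  have h3 := Measure.rnDeriv_lt_top (ν - μ) μ
  rw [eLpNorm_one_eq_lintegral_enorm]
  calc ∫⁻ x, ‖(ν.rnDeriv μ x).toReal - 1‖ₑ ∂μ = ∫⁻ x, (ν - μ).rnDeriv μ x ∂μ := by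
        refine lintegral_congr_ae ?_
        filter_upwards [h1, h3] with x hx hx'
        rw [hx, Pi.add_apply, Pi.one_apply, ENNReal.toReal_add hx'.ne ENNReal.one_ne_top,
          ENNReal.toReal_one, add_sub_cancel_right, Real.enorm_of_nonneg ENNReal.toReal_nonneg,
          ENNReal.ofReal_toReal hx'.ne]
    _ ≤ (ν - μ) univ := Measure.lintegral_rnDeriv_le
    _ = ν univ - μ univ := Measure.sub_apply MeasurableSet.univ h

/-- A family of densities `q t` on `[t₀, ∞)` or `(t₀, ∞)` with logarithmic derivative
`(n / t) (L - 1)`, where `0 ≤ L ≤ 1`, together with a nonnegative function `k` such that `k L`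
and `(n / t²) (1 - L)` have the same integral. -/
structure IsDensityFlow {X : Type*} [TopologicalSpace X] [MeasurableSpace X] (n : ℕ) (I : Set ℝ)
    (μ : Measure X) (q L k : ℝ → X → ℝ) : Prop where
  dim_pos : 0 < n
  future : ∃ t₀ : ℝ, I = Ici t₀ ∨ I = Ioi t₀
  time_pos : ∀ t ∈ I, 0 < t
  continuousOn_q : ContinuousOn (fun p : ℝ × X => q p.1 p.2) (I ×ˢ univ)
  continuousOn_L : ContinuousOn (fun p : ℝ × X => L p.1 p.2) (I ×ˢ univ)
  continuousOn_k : ContinuousOn (fun p : ℝ × X => k p.1 p.2) (I ×ˢ univ)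
  q_pos : ∀ t ∈ I, ∀ x, 0 < q t x
  L_nonneg : ∀ t ∈ I, ∀ x, 0 ≤ L t x
  L_le_one : ∀ t ∈ I, ∀ x, L t x ≤ 1
  k_nonneg : ∀ t ∈ I, ∀ x, 0 ≤ k t x
  hasDeriv : ∀ t ∈ I, ∀ x, HasDerivWithinAt (fun τ => q τ x) (q t x * (n / t * (L t x - 1))) I t
  integral_eq : ∀ t ∈ I,
    ∫⁻ x, ENNReal.ofReal (k t x * L t x) ∂(μ.withDensity fun x => ENNReal.ofReal (q t x)) =
      ENNReal.ofReal (n / t ^ 2) *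
        ∫⁻ x, ENNReal.ofReal (1 - L t x) ∂(μ.withDensity fun x => ENNReal.ofReal (q t x))

namespace IsDensityFlow

variable {X : Type*} [TopologicalSpace X] [MeasurableSpace X] {n : ℕ} {I : Set ℝ} {μ : Measure X}
  {q L k : ℝ → X → ℝ} (hQ : IsDensityFlow n I μ q L k)

include hQ

theorem convex : Convex ℝ I := by
  obtain ⟨t₀, rfl | rfl⟩ := hQ.future
  · exact convex_Ici t₀
  · exact convex_Ioi t₀

theorem mem_of_le {a b : ℝ} (ha : a ∈ I) (hab : a ≤ b) : b ∈ I := by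
  obtain ⟨t₀, rfl | rfl⟩ := hQ.future
  · exact le_trans (mem_Ici.1 ha) hab
  · exact lt_of_lt_of_le (mem_Ioi.1 ha) hab

theorem mem_nhds_of_lt {a b : ℝ} (ha : a ∈ I) (hab : a < b) : I ∈ 𝓝 b :=
  mem_of_superset (Ioi_mem_nhds hab) fun _ hx => hQ.mem_of_le ha (le_of_lt hx)

theorem nonempty : I.Nonempty := by
  obtain ⟨t₀, rfl | rfl⟩ := hQ.future
  · exact nonempty_Ici
  · exact nonempty_Ioi

theorem antitoneOn (x : X) : AntitoneOn (fun t => q t x) I := by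
  refine antitoneOn_of_hasDerivWithinAt_nonpos hQ.convex
    (fun t ht => (hQ.hasDeriv t ht x).continuousWithinAt)
    (fun t ht => (hQ.hasDeriv t (interior_subset ht) x).mono interior_subset) fun t ht => ?_
  have ht' := interior_subset ht
  have h1 := hQ.q_pos t ht' x
  have h2 : (0 : ℝ) ≤ n / t := div_nonneg (Nat.cast_nonneg _) (hQ.time_pos t ht').le
  exact mul_nonpos_of_nonneg_of_nonpos h1.le
    (mul_nonpos_of_nonneg_of_nonpos h2 (by linarith [hQ.L_le_one t ht' x]))

theorem withDensity_antitoneOn :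
    AntitoneOn (fun t => μ.withDensity fun x => ENNReal.ofReal (q t x)) I :=
  fun _ ha _ hb hab => withDensity_mono
    (Eventually.of_forall fun x => ENNReal.ofReal_le_ofReal (hQ.antitoneOn x ha hb hab))

variable [BorelSpace X]

-- The `u`-derivative of `q (s * u) x` is `-(n/u)(1 - L) q`. The weight `Λ/u` is at least one on the
-- interval and turns the integrand into an exact derivative. The strict inequality `a < s * Λ⁻¹`
-- makes the derivatives two-sided up to the left end.
omit [BorelSpace X] in
theorem integral_one_sub_L_le (x : X) {Λ s a : ℝ} (hΛ : 1 < Λ) (ha : a ∈ I) (has : a < s * Λ⁻¹) :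
    ∫⁻ u in Icc Λ⁻¹ Λ, ENNReal.ofReal ((1 - L (s * u) x) * q (s * u) x) ≤
      ENNReal.ofReal (Λ / n) *
        (ENNReal.ofReal (q (s * Λ⁻¹) x) - ENNReal.ofReal (q (s * Λ) x)) := by
  have hΛ0 : 0 < Λ := by linarith
  have hΛi : Λ⁻¹ ≤ Λ := (inv_le_one_of_one_le₀ hΛ.le).trans hΛ.le
  have hs : 0 < s := by
    have : 0 < s * Λ⁻¹ := (hQ.time_pos a ha).trans has
    exact pos_of_mul_pos_left this (inv_pos.2 hΛ0).le
  have hn : (0 : ℝ) < n := by exact_mod_cast hQ.dim_pos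
  have hlt : ∀ u ∈ Icc Λ⁻¹ Λ, a < s * u := fun u hu =>
    has.trans_le (mul_le_mul_of_nonneg_left hu.1 hs.le)
  have hmem : ∀ u ∈ Icc Λ⁻¹ Λ, s * u ∈ I := fun u hu => hQ.mem_of_le ha (hlt u hu).le
  have hupos : ∀ u ∈ Icc Λ⁻¹ Λ, 0 < u := fun u hu => (inv_pos.2 hΛ0).trans_le hu.1
  have hderiv : ∀ u ∈ uIcc Λ⁻¹ Λ, HasDerivAt (fun u => -(Λ / n) * q (s * u) x)
      (Λ / u * ((1 - L (s * u) x) * q (s * u) x)) u := by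
    intro u hu
    rw [uIcc_of_le hΛi] at hu
    have h1 := (hQ.hasDeriv (s * u) (hmem u hu) x).hasDerivAt (hQ.mem_nhds_of_lt ha (hlt u hu))
    have h2 : HasDerivAt (fun u : ℝ => s * u) s u := by
      simpa using (hasDerivAt_id u).const_mul s
    have h3 := (h1.comp u h2).const_mul (-(Λ / n))
    refine h3.congr_deriv ?_
    have := (hupos u hu).ne'
    field_simp
    ring
  have hcomp : ∀ φ : ℝ → X → ℝ, ContinuousOn (fun p : ℝ × X => φ p.1 p.2) (I ×ˢ univ) →
      ContinuousOn (fun u => φ (s * u) x) (Icc Λ⁻¹ Λ) := fun φ hφ =>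
    hφ.comp (f := fun u : ℝ => (s * u, x)) (by fun_prop) fun u hu => ⟨hmem u hu, trivial⟩
  have hc1 : ContinuousOn (fun u => (1 - L (s * u) x) * q (s * u) x) (Icc Λ⁻¹ Λ) :=
    (continuousOn_const.sub (hcomp L hQ.continuousOn_L)).mul (hcomp q hQ.continuousOn_q)
  have hc2 : ContinuousOn (fun u => Λ / u * ((1 - L (s * u) x) * q (s * u) x)) (Icc Λ⁻¹ Λ) :=
    (continuousOn_const.div continuousOn_id fun u hu => (hupos u hu).ne').mul hc1
  have hnn : ∀ u ∈ Icc Λ⁻¹ Λ, 0 ≤ (1 - L (s * u) x) * q (s * u) x := fun u hu =>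
    mul_nonneg (sub_nonneg.2 (hQ.L_le_one _ (hmem u hu) x)) (hQ.q_pos _ (hmem u hu) x).le
  have hle : ∀ u ∈ Icc Λ⁻¹ Λ, (1 - L (s * u) x) * q (s * u) x ≤
      Λ / u * ((1 - L (s * u) x) * q (s * u) x) := fun u hu =>
    le_mul_of_one_le_left (hnn u hu) ((one_le_div (hupos u hu)).2 hu.2)
  have hint : ∫ u in Icc Λ⁻¹ Λ, Λ / u * ((1 - L (s * u) x) * q (s * u) x) =
      Λ / n * (q (s * Λ⁻¹) x - q (s * Λ) x) := by
    rw [integral_Icc_eq_integral_Ioc, ← intervalIntegral.integral_of_le hΛi,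
      intervalIntegral.integral_eq_sub_of_hasDerivAt hderiv
        (ContinuousOn.intervalIntegrable (by rwa [uIcc_of_le hΛi]))]
    ring
  calc ∫⁻ u in Icc Λ⁻¹ Λ, ENNReal.ofReal ((1 - L (s * u) x) * q (s * u) x)
      ≤ ∫⁻ u in Icc Λ⁻¹ Λ, ENNReal.ofReal (Λ / u * ((1 - L (s * u) x) * q (s * u) x)) :=
        setLIntegral_mono' measurableSet_Icc fun u hu => ENNReal.ofReal_le_ofReal (hle u hu)
    _ = ENNReal.ofReal (∫ u in Icc Λ⁻¹ Λ, Λ / u * ((1 - L (s * u) x) * q (s * u) x)) := by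
        rw [ofReal_integral_eq_lintegral_ofReal (hc2.integrableOn_compact isCompact_Icc)]
        exact (ae_restrict_iff' measurableSet_Icc).2
          (Eventually.of_forall fun u hu => (hnn u hu).trans (hle u hu))
    _ = _ := by
        rw [hint, ENNReal.ofReal_mul (div_nonneg hΛ0.le hn.le), ENNReal.ofReal_sub]
        exact (hQ.q_pos _ (hmem Λ ⟨hΛi, le_rfl⟩) x).le

variable [SecondCountableTopology X] [IsFiniteMeasure μ]

omit hQ [IsFiniteMeasure μ] in
theorem aestronglyMeasurable_rescaled {φ : ℝ → X → ℝ}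
    (hφ : ContinuousOn (fun p : ℝ × X => φ p.1 p.2) (I ×ˢ univ)) {J : Set ℝ}
    (hJ : MeasurableSet J) {s : ℝ} (hs : ∀ u ∈ J, s * u ∈ I) (ν : Measure X) [SFinite ν] :
    AEStronglyMeasurable (fun p : ℝ × X => φ (s * p.1) p.2) ((volume.restrict J).prod ν) := by
  have h1 : ContinuousOn (fun p : ℝ × X => φ (s * p.1) p.2) (J ×ˢ univ) :=
    hφ.comp (f := fun p : ℝ × X => (s * p.1, p.2)) (by fun_prop) fun p hp => ⟨hs _ hp.1, trivial⟩
  have h2 : (volume.restrict J).prod ν = (volume.prod ν).restrict (J ×ˢ univ) := by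
    rw [← Measure.prod_restrict, Measure.restrict_univ]
  rw [h2]
  exact h1.aestronglyMeasurable (hJ.prod MeasurableSet.univ)

/-- After exchanging the integrals by Tonelli, the pointwise estimate in `x` integrates to the mass
lost between the times `s/Λ` and `sΛ`. -/
theorem lintegral_one_sub_L_le {Λ s a : ℝ} (hΛ : 1 < Λ) (ha : a ∈ I) (has : a < s * Λ⁻¹)
    [CompactSpace X] :
    ∫⁻ u in Icc Λ⁻¹ Λ, ∫⁻ x, ENNReal.ofReal (1 - L (s * u) x)
        ∂(μ.withDensity fun x => ENNReal.ofReal (q (s * u) x)) ≤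
      ENNReal.ofReal (Λ / n) *
        ((μ.withDensity fun x => ENNReal.ofReal (q (s * Λ⁻¹) x)) univ -
          (μ.withDensity fun x => ENNReal.ofReal (q (s * Λ) x)) univ) := by
  have hΛ0 : 0 < Λ := by linarith
  have hΛi : Λ⁻¹ ≤ Λ := (inv_le_one_of_one_le₀ hΛ.le).trans hΛ.le
  have hs : 0 < s := by
    have : 0 < s * Λ⁻¹ := (hQ.time_pos a ha).trans has
    exact pos_of_mul_pos_left this (inv_pos.2 hΛ0).le
  have hmem : ∀ u ∈ Icc Λ⁻¹ Λ, s * u ∈ I := fun u hu =>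
    hQ.mem_of_le ha (has.le.trans (mul_le_mul_of_nonneg_left hu.1 hs.le))
  have hqc := fun t (ht : t ∈ I) => FlowData.continuous_slice hQ.continuousOn_q ht
  have hLc := fun t (ht : t ∈ I) => FlowData.continuous_slice hQ.continuousOn_L ht
  calc ∫⁻ u in Icc Λ⁻¹ Λ, ∫⁻ x, ENNReal.ofReal (1 - L (s * u) x)
        ∂(μ.withDensity fun x => ENNReal.ofReal (q (s * u) x))
      = ∫⁻ u in Icc Λ⁻¹ Λ, ∫⁻ x, ENNReal.ofReal ((1 - L (s * u) x) * q (s * u) x) ∂μ := by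
        refine setLIntegral_congr_fun measurableSet_Icc fun u hu => ?_
        have h1 := hqc _ (hmem u hu)
        have h2 := hLc _ (hmem u hu)
        rw [lintegral_withDensity_eq_lintegral_mul _ (by fun_prop) (by fun_prop)]
        refine lintegral_congr fun x => ?_
        rw [Pi.mul_apply, mul_comm, ENNReal.ofReal_mul
          (sub_nonneg.2 (hQ.L_le_one _ (hmem u hu) x))]
    _ = ∫⁻ x, (∫⁻ u in Icc Λ⁻¹ Λ, ENNReal.ofReal ((1 - L (s * u) x) * q (s * u) x)) ∂μ := by
        refine lintegral_lintegral_swap ?_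
        exact (aestronglyMeasurable_rescaled (φ := fun t x => (1 - L t x) * q t x)
          ((continuousOn_const.sub hQ.continuousOn_L).mul hQ.continuousOn_q)
          measurableSet_Icc hmem μ).aemeasurable.ennreal_ofReal
    _ ≤ ∫⁻ x, ENNReal.ofReal (Λ / n) *
        (ENNReal.ofReal (q (s * Λ⁻¹) x) - ENNReal.ofReal (q (s * Λ) x)) ∂μ :=
        lintegral_mono fun x => hQ.integral_one_sub_L_le x hΛ ha has
    _ = _ := by
        have m1 := hmem Λ⁻¹ ⟨le_rfl, hΛi⟩
        have m2 := hmem Λ ⟨hΛi, le_rfl⟩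
        have h1 := hqc _ m1
        have h2 := hqc _ m2
        have hfin : ∫⁻ x, ENNReal.ofReal (q (s * Λ) x) ∂μ ≠ ⊤ :=
          (h2.integrable_of_hasCompactSupport
            (HasCompactSupport.of_compactSpace _)).lintegral_lt_top.ne
        rw [lintegral_const_mul _ (by fun_prop), lintegral_sub (by fun_prop) hfin
          (Eventually.of_forall fun x => ENNReal.ofReal_le_ofReal
            (hQ.antitoneOn x m1 m2 (mul_le_mul_of_nonneg_left hΛi hs.le))),
          withDensity_apply _ MeasurableSet.univ, withDensity_apply _ MeasurableSet.univ,
          Measure.restrict_univ]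

omit [SecondCountableTopology X] in
/-- The measures with density `q t` converge setwise to a finite measure that they dominate. -/
theorem exists_limit [CompactSpace X] :
    ∃ ν : Measure X, IsFiniteMeasure ν ∧
      (∀ A : Set X, MeasurableSet A →
        Tendsto (fun t => (μ.withDensity fun x => ENNReal.ofReal (q t x)) A) atTop (𝓝 (ν A))) ∧
      (∀ t ∈ I, ν ≤ μ.withDensity fun x => ENNReal.ofReal (q t x)) := by
  obtain ⟨a, ha⟩ := hQ.nonempty
  have hmem : ∀ t, max a t ∈ I := fun t => hQ.mem_of_le ha (le_max_left _ _)
  have hqc := fun t (ht : t ∈ I) => FlowData.continuous_slice hQ.continuousOn_q ht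
  -- Replacing `t` by `max a t` makes the family monotone on all of `ℝ` without changing it at late
  -- times. The density at time `a` is the dominating function.
  let g : X → ℝ≥0∞ := fun x => ⨅ t : ℝ, ENNReal.ofReal (q (max a t) x)
  have hanti : ∀ x, Antitone fun t : ℝ => ENNReal.ofReal (q (max a t) x) := fun x t t' h =>
    ENNReal.ofReal_le_ofReal (hQ.antitoneOn x (hmem t) (hmem t') (max_le_max le_rfl h))
  have hlim : ∀ x, Tendsto (fun t : ℝ => ENNReal.ofReal (q (max a t) x)) atTop (𝓝 (g x)) :=
    fun x => tendsto_atTop_iInf (hanti x)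
  have hmeas : ∀ t : ℝ, Measurable fun x => ENNReal.ofReal (q (max a t) x) := fun t =>
    (hqc _ (hmem t)).measurable.ennreal_ofReal
  have hfin : ∀ t ∈ I, ∫⁻ x, ENNReal.ofReal (q t x) ∂μ ≠ ⊤ := fun t ht =>
    ((hqc t ht).integrable_of_hasCompactSupport
      (HasCompactSupport.of_compactSpace _)).lintegral_lt_top.ne
  have hle : ∀ t ∈ I, ∀ x, g x ≤ ENNReal.ofReal (q t x) := fun t ht x =>
    (iInf_le _ t).trans (ENNReal.ofReal_le_ofReal
      (hQ.antitoneOn x ht (hmem t) (le_max_right _ _)))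
  refine ⟨μ.withDensity g, ?_, ?_, ?_⟩
  · refine isFiniteMeasure_withDensity ?_
    exact ((lintegral_mono fun x => hle a ha x).trans_lt (hfin a ha).lt_top).ne
  · intro A hA
    rw [withDensity_apply _ hA]
    have h1 : Tendsto (fun t : ℝ => ∫⁻ x in A, ENNReal.ofReal (q (max a t) x) ∂μ) atTop
        (𝓝 (∫⁻ x in A, g x ∂μ)) := by
      refine tendsto_lintegral_filter_of_dominated_convergence
        (fun x => ENNReal.ofReal (q a x)) (Eventually.of_forall hmeas)
        (Eventually.of_forall fun t => Eventually.of_forall fun x => ?_)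
        ((setLIntegral_le_lintegral A _).trans_lt (hfin a ha).lt_top).ne
        (Eventually.of_forall hlim)
      exact ENNReal.ofReal_le_ofReal (hQ.antitoneOn x ha (hmem t) (le_max_left _ _))
    refine h1.congr' ?_
    filter_upwards [eventually_ge_atTop a] with t ht
    rw [withDensity_apply _ hA, max_eq_right ht]
  · exact fun t ht => withDensity_mono (Eventually.of_forall (hle t ht))

variable {ν : Measure X} [IsFiniteMeasure ν]
  (hν : ∀ t ∈ I, ν ≤ μ.withDensity fun x => ENNReal.ofReal (q t x))
  (hlim : Tendsto (fun t => (μ.withDensity fun x => ENNReal.ofReal (q t x)) univ) atTop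
    (𝓝 (ν univ)))

-- Both masses converge to the same finite limit, so their difference tends to zero.
omit hQ [TopologicalSpace X] [BorelSpace X] [SecondCountableTopology X] [IsFiniteMeasure μ] in
include hlim in
theorem tendsto_mass_sub {Λ : ℝ} (hΛ : 1 < Λ) (C : ℝ) :
    Tendsto (fun s : ℝ => ENNReal.ofReal C *
      ((μ.withDensity fun x => ENNReal.ofReal (q (s * Λ⁻¹) x)) univ -
        (μ.withDensity fun x => ENNReal.ofReal (q (s * Λ) x)) univ)) atTop (𝓝 0) := by
  have hΛ0 : 0 < Λ := by linarith
  have h1 := hlim.comp (tendsto_id.atTop_mul_const (inv_pos.2 hΛ0))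
  have h2 := hlim.comp (tendsto_id.atTop_mul_const hΛ0)
  have h3 := ENNReal.Tendsto.sub h1 h2 (Or.inl (measure_ne_top ν univ))
  rw [tsub_self] at h3
  have h4 := ENNReal.Tendsto.const_mul (a := ENNReal.ofReal C) h3 (Or.inr ENNReal.ofReal_ne_top)
  rwa [mul_zero] at h4

omit [BorelSpace X] [SecondCountableTopology X] [IsFiniteMeasure μ] in
theorem eventually_rescaled {Λ : ℝ} (hΛ : 1 < Λ) :
    ∀ᶠ s in atTop, 0 < s ∧ (∃ a ∈ I, a < s * Λ⁻¹) ∧ ∀ u ∈ Icc Λ⁻¹ Λ, s * u ∈ I := by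
  have hΛ0 : 0 < Λ := by linarith
  obtain ⟨a, ha⟩ := hQ.nonempty
  filter_upwards [eventually_gt_atTop 0,
    (tendsto_id.atTop_mul_const (inv_pos.2 hΛ0)).eventually (eventually_gt_atTop a)] with s h1 h2
  exact ⟨h1, ⟨a, ha, h2⟩, fun u hu =>
    hQ.mem_of_le ha ((le_of_lt h2).trans (mul_le_mul_of_nonneg_left hu.1 h1.le))⟩

-- The measure `ν` lies below the measure at every time `s * u`, so the integral may be taken
-- against the latter, where the mass estimate applies.
include hν hlim in
theorem tendstoZeroL1_L [CompactSpace X] {Λ : ℝ} (hΛ : 1 < Λ) :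
    TendstoZeroL1 ((volume.restrict (Icc Λ⁻¹ Λ)).prod ν) (fun s p => L (s * p.1) p.2 - 1) := by
  have hm : ∀ s : ℝ, (∀ u ∈ Icc Λ⁻¹ Λ, s * u ∈ I) → AEStronglyMeasurable
      (fun p : ℝ × X => L (s * p.1) p.2 - 1) ((volume.restrict (Icc Λ⁻¹ Λ)).prod ν) := fun s hs =>
    aestronglyMeasurable_rescaled (φ := fun t x => L t x - 1)
      (hQ.continuousOn_L.sub continuousOn_const) measurableSet_Icc hs ν
  refine tendstoZeroL1_of_le ?_ ?_ (tendsto_mass_sub hlim hΛ (Λ / n))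
  · filter_upwards [hQ.eventually_rescaled hΛ] with s hs using hm s hs.2.2
  · filter_upwards [hQ.eventually_rescaled hΛ] with s hs
    obtain ⟨hs0, ⟨a, ha, has⟩, hmem⟩ := hs
    rw [eLpNorm_one_eq_lintegral_enorm, lintegral_prod _ (hm s hmem).enorm]
    refine le_trans ?_ (hQ.lintegral_one_sub_L_le hΛ ha has)
    refine setLIntegral_mono' measurableSet_Icc fun u hu => ?_
    refine le_trans (le_of_eq ?_) (lintegral_mono' (hν _ (hmem u hu)) le_rfl)
    refine lintegral_congr fun x => ?_
    rw [← enorm_neg, neg_sub,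
      Real.enorm_of_nonneg (sub_nonneg.2 (hQ.L_le_one _ (hmem u hu) x))]

include hν hlim in
theorem tendstoZeroL1_k_mul_L [CompactSpace X] {Λ : ℝ} (hΛ : 1 < Λ) :
    TendstoZeroL1 ((volume.restrict (Icc Λ⁻¹ Λ)).prod ν)
      (fun s p => s ^ 2 * k (s * p.1) p.2 * L (s * p.1) p.2) := by
  have hΛ0 : 0 < Λ := by linarith
  have hn : (0 : ℝ) < n := by exact_mod_cast hQ.dim_pos
  have hm : ∀ s : ℝ, (∀ u ∈ Icc Λ⁻¹ Λ, s * u ∈ I) → AEStronglyMeasurable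
      (fun p : ℝ × X => s ^ 2 * k (s * p.1) p.2 * L (s * p.1) p.2)
      ((volume.restrict (Icc Λ⁻¹ Λ)).prod ν) := fun s hs =>
    aestronglyMeasurable_rescaled (φ := fun t x => s ^ 2 * k t x * L t x)
      ((continuousOn_const.mul hQ.continuousOn_k).mul hQ.continuousOn_L) measurableSet_Icc hs ν
  -- The integral identity replaces `s² k L` by `s² (n/(su)²)(1 - L) = n u⁻² (1 - L)`, and `u⁻¹ ≤
  -- Λ`. The remaining factor `Λ/n` is that of the mass estimate.
  refine tendstoZeroL1_of_le ?_ ?_ (tendsto_mass_sub hlim hΛ (n * Λ ^ 2 * (Λ / n)))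
  · filter_upwards [hQ.eventually_rescaled hΛ] with s hs using hm s hs.2.2
  · filter_upwards [hQ.eventually_rescaled hΛ] with s hs
    obtain ⟨hs0, ⟨a, ha, has⟩, hmem⟩ := hs
    rw [eLpNorm_one_eq_lintegral_enorm, lintegral_prod _ (hm s hmem).enorm]
    rw [ENNReal.ofReal_mul (by positivity), mul_assoc]
    refine le_trans ?_ (mul_le_mul_right (hQ.lintegral_one_sub_L_le hΛ ha has) _)
    rw [← lintegral_const_mul' _ _ ENNReal.ofReal_ne_top]
    refine setLIntegral_mono' measurableSet_Icc fun u hu => ?_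
    have hu0 : 0 < u := (inv_pos.2 hΛ0).trans_le hu.1
    have hmu := hmem u hu
    have e1 : ∀ x, ‖s ^ 2 * k (s * u) x * L (s * u) x‖ₑ =
        ENNReal.ofReal (s ^ 2) * ENNReal.ofReal (k (s * u) x * L (s * u) x) := fun x => by
      have h1 := mul_nonneg (hQ.k_nonneg _ hmu x) (hQ.L_nonneg _ hmu x)
      rw [mul_assoc, Real.enorm_of_nonneg (mul_nonneg (sq_nonneg s) h1),
        ENNReal.ofReal_mul (sq_nonneg s)]
    calc ∫⁻ x, ‖s ^ 2 * k (s * u) x * L (s * u) x‖ₑ ∂ν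
        ≤ ∫⁻ x, ENNReal.ofReal (s ^ 2) * ENNReal.ofReal (k (s * u) x * L (s * u) x)
            ∂(μ.withDensity fun x => ENNReal.ofReal (q (s * u) x)) := by
          simp only [e1]
          exact lintegral_mono' (hν _ hmu) le_rfl
      _ = ENNReal.ofReal (s ^ 2 * (n / (s * u) ^ 2)) *
            ∫⁻ x, ENNReal.ofReal (1 - L (s * u) x)
              ∂(μ.withDensity fun x => ENNReal.ofReal (q (s * u) x)) := by
          rw [lintegral_const_mul' _ _ ENNReal.ofReal_ne_top, hQ.integral_eq _ hmu,
            ENNReal.ofReal_mul (sq_nonneg s), mul_assoc]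
      _ ≤ _ := by
          refine mul_le_mul_left (ENNReal.ofReal_le_ofReal ?_) _
          have e2 : s ^ 2 * (n / (s * u) ^ 2) = n * u⁻¹ ^ 2 := by
            field_simp
          rw [e2]
          have h3 : u⁻¹ ≤ Λ := inv_le_of_inv_le₀ hΛ0 hu.1
          have h4 : 0 ≤ u⁻¹ := (inv_pos.2 hu0).le
          gcongr

end IsDensityFlow

end

/-! ### The normalized volume of an expanding CMC Einstein flow -/

theorem TendstoZeroL1.congr {α : Type*} [MeasurableSpace α] {μ : Measure α} {f g : ℝ → α → ℝ}
    (hf : TendstoZeroL1 μ f) (hfg : ∀ᶠ s in atTop, f s =ᵐ[μ] g s) : TendstoZeroL1 μ g := by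
  refine ⟨?_, hf.2.congr' ?_⟩
  · filter_upwards [hf.1, hfg] with s h1 h2 using (memLp_congr_ae h2).1 h1
  · filter_upwards [hfg] with s h2 using eLpNorm_congr_ae h2

theorem ae_fst_mem_of_restrict {X : Type*} [MeasurableSpace X] {J : Set ℝ} (hJ : MeasurableSet J)
    (ν : Measure X) [SFinite ν] : ∀ᵐ p ∂((volume.restrict J).prod ν), p.1 ∈ J := by
  have h2 : (volume.restrict J).prod ν = (volume.prod ν).restrict (J ×ˢ univ) := by
    rw [← Measure.prod_restrict, Measure.restrict_univ]
  rw [h2]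
  filter_upwards [ae_restrict_mem (hJ.prod MeasurableSet.univ)] with p hp using hp.1

theorem tendstoZeroL1_zero_measure {α : Type*} [MeasurableSpace α] (f : ℝ → α → ℝ) :
    TendstoZeroL1 (0 : Measure α) f :=
  ⟨Eventually.of_forall fun s => by simp [MemLp], by simp⟩

namespace FlowData

variable {n : ℕ} {X : Type*} [TopologicalSpace X] [ChartedSpace (Coord n) X]
  [IsManifold (𝓡 n) ∞ X] {I : Set ℝ} {F : FlowData n X}

-- This is the Hamiltonian constraint with `H = -n/t`. The deviation of `R` from its hyperbolic
-- value is exactly `|K^0|^2`, in particular nonnegative.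
omit [IsManifold (𝓡 n) ∞ X] in
theorem IsExpandingCMC.R_eq [Nonempty X] (hF : F.IsExpandingCMC I) (hH : F.IsHubbleTime I)
    {t : ℝ} (ht : t ∈ I) (x : X) :
    F.R t x = F.K0sq t x - n * (n - 1) / t ^ 2 := by
  have h1 : F.R t x - F.K0sq t x + (1 - 1 / (n : ℝ)) * F.H t x ^ 2 = 0 :=
    hF.hamiltonian t ht _ (chart_mem_atlas (Coord n) x) _ (mem_chart_target (Coord n) x)
  have hn : (n : ℝ) ≠ 0 := by exact_mod_cast (hF.dim_pos hH).ne'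
  have h2 : (1 - 1 / (n : ℝ)) * F.H t x ^ 2 = n * (n - 1) / t ^ 2 := by
    rw [hF.H_eq hH ht x]
    field_simp
  linarith

variable [CompactSpace X] [T2Space X] [MeasurableSpace X] [BorelSpace X]

omit [T2Space X] in
theorem IsExpandingCMC.normalizedVolume_eq [Nonempty X] (hF : F.IsExpandingCMC I)
    (hH : F.IsHubbleTime I) {t₁ t : ℝ} (ht₁ : t₁ ∈ I) (ht : t ∈ I) :
    F.normalizedVolume t =
      (F.h t₁).volumeMeasure.withDensity fun x => ENNReal.ofReal (F.density t₁ t x) := by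
  have htp : 0 < t ^ n := pow_pos (hF.time_pos hH ht) n
  have hm : Measurable fun x => Real.sqrt (((F.h t).mat x).det / ((F.h t₁).mat x).det) := by
    have h1 := (continuous_slice (hF.continuousOn_density hH ht₁) ht).measurable.const_mul (t ^ n)
    simpa only [density, mul_inv_cancel_left₀ htp.ne'] using h1
  rw [normalizedVolume, volumeMeasure_eq_withDensity (hF.isRiemannian ht₁) hm,
    ← withDensity_smul _ hm.ennreal_ofReal]
  congr 1
  ext x
  rw [Pi.smul_apply, smul_eq_mul, density, ENNReal.ofReal_mul (inv_pos.2 htp).le]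

theorem IsExpandingCMC.isDensityFlow [Nonempty X] (hF : F.IsExpandingCMC I)
    (hH : F.IsHubbleTime I) {t₁ : ℝ} (ht₁ : t₁ ∈ I) :
    IsDensityFlow n I (F.h t₁).volumeMeasure (F.density t₁) F.L F.K0sq where
  dim_pos := hF.dim_pos hH
  future := hF.future
  time_pos _ ht := hF.time_pos hH ht
  continuousOn_q := hF.continuousOn_density hH ht₁
  continuousOn_L := hF.continuousOn_L
  continuousOn_k := hF.continuousOn_K0sq
  q_pos _ ht x := hF.density_pos hH ht₁ ht x
  L_nonneg := hF.lapse_nonneg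
  L_le_one _ ht x := hF.lapse_le_one hH ht x
  k_nonneg _ ht x := hF.K0sq_nonneg ht x
  hasDeriv _ ht x := hF.hasDerivWithinAt_density hH ht₁ ht x
  -- Both sides carry the same factor `t⁻ⁿ` of the normalized volume, so the identity for `h t`
  -- itself suffices; nonnegativity of both integrands allows the passage to `lintegral`.
  integral_eq t ht := by
    have := (hF.isRiemannian ht).isLocallyFiniteMeasure
    have hL : Continuous (F.L t) := continuous_slice hF.continuousOn_L ht
    have hK : Continuous (F.K0sq t) := continuous_slice hF.continuousOn_K0sq ht
    have hint : ∀ φ : X → ℝ, Continuous φ → Integrable φ (F.h t).volumeMeasure := fun φ hφ =>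
      hφ.integrable_of_hasCompactSupport (HasCompactSupport.of_compactSpace _)
    rw [← hF.normalizedVolume_eq hH ht₁ ht, normalizedVolume, lintegral_smul_measure,
      lintegral_smul_measure, ← ofReal_integral_eq_lintegral_ofReal
        (hint (fun x => F.K0sq t x * F.L t x) (hK.mul hL)) (Eventually.of_forall fun x =>
          mul_nonneg (hF.K0sq_nonneg ht x) (hF.lapse_nonneg t ht x)),
      ← ofReal_integral_eq_lintegral_ofReal
        (hint (fun x => 1 - F.L t x) (continuous_const.sub hL)) (Eventually.of_forall fun x =>
          sub_nonneg.2 (hF.lapse_le_one hH ht x)),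
      hF.integral_K0sq_mul_L hH ht, ENNReal.ofReal_mul (by positivity)]
    simp only [smul_eq_mul]
    ring

end FlowData

theorem proposition1p37 {n : ℕ} {X : Type*} [TopologicalSpace X] [ChartedSpace (Coord n) X]
    [IsManifold (𝓡 n) ∞ X] [T2Space X] [CompactSpace X] [MeasurableSpace X] [BorelSpace X]
    (I : Set ℝ) (F : FlowData n X) (hF : F.IsExpandingCMC I) (ht : F.IsHubbleTime I) :
    AntitoneOn F.normalizedVolume I ∧
    ∃ volInf : Measure X, IsFiniteMeasure volInf ∧
      (∀ A : Set X, MeasurableSet A →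
        Tendsto (fun t => F.normalizedVolume t A) atTop (𝓝 (volInf A))) ∧
      (∀ t ∈ I, volInf ≪ (F.h t).volumeMeasure) ∧
      TendstoZeroL1 volInf
        (fun t x => ((F.normalizedVolume t).rnDeriv volInf x).toReal - 1) ∧
      ∀ Λ : ℝ, 1 < Λ →
        TendstoZeroL1 ((volume.restrict (Icc Λ⁻¹ Λ)).prod volInf)
          (fun s p => (F.rescale s).L p.1 p.2 - 1) ∧
        TendstoZeroL1 ((volume.restrict (Icc Λ⁻¹ Λ)).prod volInf)
          (fun s p => (F.rescale s).K0sq p.1 p.2 * (F.rescale s).L p.1 p.2) ∧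
        TendstoZeroL1 ((volume.restrict (Icc Λ⁻¹ Λ)).prod volInf)
          (fun s p => |(F.rescale s).R p.1 p.2 + n * (n - 1) / p.1 ^ 2|
            * (F.rescale s).L p.1 p.2) := by
  rcases isEmpty_or_nonempty X with hX | hX
  -- On the empty manifold the Hubble time condition is vacuous and gives no positivity of `n` or
  -- `t`, but every measure is zero.
  · have h0 : ∀ μ : Measure X, μ = 0 := fun μ => Measure.eq_zero_of_isEmpty μ
    refine ⟨fun a _ b _ _ => by rw [h0 (F.normalizedVolume a), h0 (F.normalizedVolume b)], 0,
      inferInstance, fun A _ => ?_, fun t _ => Measure.AbsolutelyContinuous.zero _,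
      tendstoZeroL1_zero_measure _, fun Λ _ => ?_⟩
    · simp only [h0 (F.normalizedVolume _)]
      exact tendsto_const_nhds
    · rw [Measure.prod_zero]
      exact ⟨tendstoZeroL1_zero_measure _, tendstoZeroL1_zero_measure _,
        tendstoZeroL1_zero_measure _⟩
  have : SecondCountableTopology X := ChartedSpace.secondCountable_of_sigmaCompact (Coord n) X
  obtain ⟨t₁, ht₁⟩ := hF.eventually_mem.exists
  have hQ := hF.isDensityFlow ht ht₁
  have := (hF.isRiemannian ht₁).isLocallyFiniteMeasure
  have heq := fun t (h : t ∈ I) => hF.normalizedVolume_eq ht ht₁ h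
  obtain ⟨ν, hfin, hlim, hle⟩ := hQ.exists_limit
  have hlim' : ∀ A : Set X, MeasurableSet A →
      Tendsto (fun t => F.normalizedVolume t A) atTop (𝓝 (ν A)) := fun A hA => by
    refine (hlim A hA).congr' ?_
    filter_upwards [hF.eventually_mem] with t h
    rw [heq t h]
  have hle' : ∀ t ∈ I, ν ≤ F.normalizedVolume t := fun t h => by
    rw [heq t h]
    exact hle t h
  refine ⟨fun a ha b hb hab => ?_, ν, hfin, hlim', fun t h => ?_, ?_, fun Λ hΛ => ?_⟩
  · rw [heq a ha, heq b hb]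
    exact hQ.withDensity_antitoneOn ha hb hab
  · exact (Measure.absolutelyContinuous_of_le (hle' t h)).trans
      Measure.smul_absolutelyContinuous
  · refine tendstoZeroL1_of_le (B := fun t => F.normalizedVolume t univ - ν univ)
      (Eventually.of_forall fun t => ?_) ?_ ?_
    · exact ((Measure.measurable_rnDeriv _ _).ennreal_toReal.sub
        measurable_const).aestronglyMeasurable
    · filter_upwards [hF.eventually_mem] with t h
      have := (hF.isRiemannian h).isLocallyFiniteMeasure
      have : IsFiniteMeasure (F.normalizedVolume t) :=
        Measure.smul_finite _ ENNReal.ofReal_ne_top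
      exact eLpNorm_rnDeriv_sub_one_le (hle' t h)
    · have h1 := ENNReal.Tendsto.sub (hlim' univ MeasurableSet.univ) (tendsto_const_nhds (x := ν univ))
        (Or.inl (measure_ne_top ν univ))
      rwa [tsub_self] at h1
  · have hlimu := hlim univ MeasurableSet.univ
    have h2 := hQ.tendstoZeroL1_k_mul_L hle hlimu hΛ
    refine ⟨hQ.tendstoZeroL1_L hle hlimu hΛ, h2.congr ?_, h2.congr ?_⟩
    · filter_upwards [hQ.eventually_rescaled hΛ] with s hs
      refine Eventually.of_forall fun p => ?_
      simp only [F.rescale_K0sq hs.1.ne']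
      rfl
    · filter_upwards [hQ.eventually_rescaled hΛ] with s hs
      filter_upwards [ae_fst_mem_of_restrict measurableSet_Icc ν] with p hp
      have hmem := hs.2.2 p.1 hp
      have hp0 : p.1 ≠ 0 := fun h0 => by
        have := hF.time_pos ht hmem
        rw [h0, mul_zero] at this
        exact lt_irrefl _ this
      have hs0 := hs.1.ne'
      -- By the constraint the rescaled curvature deviation equals the rescaled `|K^0|^2`, so the
      -- absolute value is superfluous and the second convergence gives the third.
      have e : (F.rescale s).R p.1 p.2 + n * (n - 1) / p.1 ^ 2 =
          s ^ 2 * F.K0sq (s * p.1) p.2 := by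
        rw [F.rescale_R hs0, hF.R_eq ht hmem]
        field_simp
        ring
      rw [e, abs_of_nonneg (mul_nonneg (sq_nonneg s) (hF.K0sq_nonneg hmem p.2))]
      rfl
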